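/- For each sample size $n$ let $p=p_n$ be an integer, let $\Sigma_Z$ be a positive definite $(p-1)\times(p-1)$ matrix, let $\theta,\xi\in\mathbb R^{p-1}$ (all may vary with $n$), and let $\mathbf Y=\mathbf X\beta+\mathbf Z\theta+\varepsilon$, where the rows $\mathbf Z_i$ of $\mathbf Z\in\mathbb R^{n\times(p-1)}$ are i.i.d. $\mathcal N(0,\Sigma_Z)$; given $\mathbf Z$, the entries of $\mathbf X\in\mathbb R^n$ are independent with $\mathbf X_i\sim\mathcal N(\mathbf Z_i^\top\xi,1)$; and $\varepsilon\sim\mathcal N(0,\sigma^2I_n)$ is independent of $(\mathbf X,\mathbf Z)$. Let $\sigma>0$ and $h>0$ be fixed, $\beta=h/\sqrt n$, and suppose that, as $n\to\infty$, $p/n\to\kappa\in(0,1)$, $\theta^\top\Sigma_Z\theta\to v_Z^2$ for some $v_Z\in\mathbb R$, and $\limsup_n \xi^\top\Sigma_Z\xi<\infty$. Let $\hat\beta=\hat\beta(\mathbf X,\mathbf Z,\mathbf Y)$ be the coefficient of $\mathbf X$ in the ordinary least squares regression of $\mathbf Y$ on $[\mathbf X,\mathbf Z]$. For a statistic $T$,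 the level-$\alpha$ conditional randomization test (CRT) rejects $H_0:\beta=0$ when $T(\mathbf X,\mathbf Z,\mathbf Y)\ge \hat c_\alpha(\mathbf Z,\mathbf Y)$, where $\hat c_\alpha(\mathbf Z,\mathbf Y)$ is the $(1-\alpha)$-quantile of the conditional law of $T(\tilde{\mathbf X},\mathbf Z,\mathbf Y)$ given $(\mathbf Z,\mathbf Y)$, with $\tilde{\mathbf X}$ drawn from the law of $\mathbf X$ given $\mathbf Z$. The one-sided CRT uses $T=\hat\beta$, the two-sided CRT uses $T=|\hat\beta|$. Let $\Phi$ be the standard normal distribution function, $z_q$ its $q$-quantile, and $$\mu=\frac h\sigma\sqrt{1-\kappa}.$$ Then for every $\alpha\in(0,1)$ the (unconditional) power of the level-$\alpha$ one-sided CRT converges to $\Phi(\mu-z_{1-\alpha})$, and that of the level-$\alpha$ two-sided CRT converges to $\Phi(\mu-z_{1-\alpha/2})+\Phi(-\mu-z_{1-\alpha/2})$, i.e. to the powers of a $z$-test with standardized effect size $\mu$. The classical fixed-$\mathbf X$ OLS tests, which reject when $\hat\beta>z_{1-\alpha}\,\sigma\sqrt{\hat\Omega_{11}}$ (one-sided)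 or $|\hat\beta|>z_{1-\alpha/2}\,\sigma\sqrt{\hat\Omega_{11}}$ (two-sided), where $\hat\Omega=([\mathbf X,\mathbf Z]^\top[\mathbf X,\mathbf Z])^{-1}$, have the same limiting powers. -/

import Mathlib

open MeasureTheory ProbabilityTheory Filter Topology
open scoped Matrix

noncomputable section

namespace CRT

/-! ### Gaussian quantiles -/

/-- The lower `q`-quantile `inf {t | q ≤ μ (-∞, t]}` of a law `μ` on `ℝ`. -/
def quantile (μ : Measure ℝ) (q : ℝ) : ℝ := sInf {t : ℝ | q ≤ μ.real (Set.Iic t)}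

/-- The standard normal distribution function `Φ`. -/
def Phi (t : ℝ) : ℝ := (gaussianReal 0 1).real (Set.Iic t)

/-- The `q`-quantile `z_q` of the standard normal law. -/
def zq (q : ℝ) : ℝ := quantile (gaussianReal 0 1) q

/-! ### The linear model with Gaussian design

The matrix of confounders is given by its rows, `z i : EuclideanSpace ℝ (Fin d)` for `i : Fin n`. -/

/-- The conditional law of the covariate vector `𝐗` given the confounders: given `𝐙 = z`, the
entries `𝐗 i` are independent with law `N(⟨z i, ξ⟩, 1)`. -/
def covariateKernel {n d : ℕ} (ξ : Fin d → ℝ) :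
    Kernel (Fin n → EuclideanSpace ℝ (Fin d)) (Fin n → ℝ) where
  toFun z := Measure.pi fun i => gaussianReal (∑ j, z i j * ξ j) 1
  measurable' := by
    have key : ∀ z : Fin n → EuclideanSpace ℝ (Fin d),
        (Measure.pi fun i => gaussianReal (∑ j, z i j * ξ j) 1) =
          (Measure.pi fun _ : Fin n => gaussianReal 0 1).map
            (fun w i => w i + ∑ j, z i j * ξ j) := by
      intro z
      have h := Measure.pi_map_pi (μ := fun _ : Fin n => gaussianReal 0 1)
        (f := fun i x => x + ∑ j, z i j * ξ j) (fun i => by fun_prop)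
      rw [h]
      simp [gaussianReal_map_add_const]
    refine Measure.measurable_of_measurable_coe _ fun s hs => ?_
    have hm : Measurable fun q : (Fin n → EuclideanSpace ℝ (Fin d)) × (Fin n → ℝ) =>
        (fun i => q.2 i + ∑ j, q.1 i j * ξ j) := by
      fun_prop
    have h2 := measurable_measure_prodMk_left
      (ν := Measure.pi fun _ : Fin n => gaussianReal 0 1) (hm hs)
    convert h2 using 2 with z
    rw [key z, Measure.map_apply (by fun_prop) hs]
    rfl

instance {n d : ℕ} (ξ : Fin d → ℝ) : IsMarkovKernel (covariateKernel (n := n) ξ) :=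
  ⟨fun z => inferInstanceAs
    (IsProbabilityMeasure (Measure.pi fun i => gaussianReal (∑ j, z i j * ξ j) 1))⟩

/-- `(X, Z, ε, Y)` on `(Ω, P)` is a sample of size `n` from the model `Y = X β + Z θ + ε`, where the
rows of `Z` are i.i.d. `N(0, S)`, given `Z` the entries of `X` are independent `N(⟨Z i, ξ⟩, 1)`, the
noise `ε` is `N(0, σ² I)`, and `(X, Z)` is independent of `ε`. -/
structure IsLinearModel {n d : ℕ} (S : Matrix (Fin d) (Fin d) ℝ) (ξ θ : Fin d → ℝ) (β σ : ℝ)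
    {Ω : Type*} [MeasurableSpace Ω] (P : Measure Ω)
    (X : Ω → Fin n → ℝ) (Z : Ω → Fin n → EuclideanSpace ℝ (Fin d)) (ε Y : Ω → Fin n → ℝ) :
    Prop where
  law_Z : HasLaw Z (Measure.pi fun _ => multivariateGaussian 0 S) P
  law_X : HasCondDistrib X Z (covariateKernel ξ) P
  law_noise : HasLaw ε (Measure.pi fun _ => gaussianReal 0 (σ ^ 2).toNNReal) P
  indep : IndepFun (fun ω => (X ω, Z ω)) ε P
  response : ∀ ω i, Y ω i = X ω i * β + ∑ j, Z ω i j * θ j + ε ω i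

/-! ### Ordinary least squares -/

/-- The full design matrix `[x, z]`, with `n` rows and `1 + d` columns. -/
def design {n d : ℕ} (x : Fin n → ℝ) (z : Fin n → EuclideanSpace ℝ (Fin d)) :
    Matrix (Fin n) (Unit ⊕ Fin d) ℝ :=
  Matrix.fromCols (Matrix.replicateCol Unit x) (Matrix.of fun i j => z i j)

/-- The matrix `([x, z]ᵀ [x, z])⁻¹`. -/
def gramInv {n d : ℕ} (x : Fin n → ℝ) (z : Fin n → EuclideanSpace ℝ (Fin d)) :
    Matrix (Unit ⊕ Fin d) (Unit ⊕ Fin d) ℝ :=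
  ((design x z)ᵀ * design x z)⁻¹

/-- The OLS coefficient of `x` in the regression of `y` on `[x, z]`, i.e. the first entry of
`([x, z]ᵀ [x, z])⁻¹ [x, z]ᵀ y`. -/
def olsCoef {n d : ℕ} (x : Fin n → ℝ) (z : Fin n → EuclideanSpace ℝ (Fin d)) (y : Fin n → ℝ) : ℝ :=
  (gramInv x z *ᵥ ((design x z)ᵀ *ᵥ y)) (Sum.inl ())

/-! ### The conditional randomization test -/

section Test

variable {𝓧 𝓩 𝓨 : Type*} [MeasurableSpace 𝓧] [MeasurableSpace 𝓩]

/-- The cutoff of the level-`α` conditional randomization test with statistic `T`: given `z` and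
`y`, the upper `α`-quantile (the `(1 - α)`-quantile) of `T x' z y`, where `x'` is drawn from the
known conditional law `K z` of the covariate given `z`. -/
def crtCutoff (K : Kernel 𝓩 𝓧) (T : 𝓧 → 𝓩 → 𝓨 → ℝ) (z : 𝓩) (y : 𝓨) (α : ℝ) : ℝ :=
  sInf {t : ℝ | 1 - α ≤ (K z).real {x' | T x' z y ≤ t}}

/-- The unconditional power of the level-`α` conditional randomization test that rejects for large
values of `T`. -/
def crtPower (K : Kernel 𝓩 𝓧) (T : 𝓧 → 𝓩 → 𝓨 → ℝ) {Ω : Type*} [MeasurableSpace Ω]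
    (P : Measure Ω) (X : Ω → 𝓧) (Z : Ω → 𝓩) (Y : Ω → 𝓨) (α : ℝ) : ℝ :=
  P.real {ω | crtCutoff K T (Z ω) (Y ω) α ≤ T (X ω) (Z ω) (Y ω)}

end Test

/-! ### The classical fixed-`X` OLS test -/

/-- The power of the classical one-sided level-`α` OLS test with known noise level `σ`, based on
`β̂ ∣ X, Z ~ N(β, σ² ([X, Z]ᵀ [X, Z])⁻¹₁₁)`. -/
def fixedXPowerOne {n d : ℕ} (σ : ℝ) {Ω : Type*} [MeasurableSpace Ω] (P : Measure Ω)
    (X : Ω → Fin n → ℝ) (Z : Ω → Fin n → EuclideanSpace ℝ (Fin d)) (Y : Ω → Fin n → ℝ)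
    (α : ℝ) : ℝ :=
  P.real {ω | zq (1 - α) * (σ * √(gramInv (X ω) (Z ω) (Sum.inl ()) (Sum.inl ()))) <
    olsCoef (X ω) (Z ω) (Y ω)}

/-- The power of the classical two-sided level-`α` OLS test with known noise level `σ`. -/
def fixedXPowerTwo {n d : ℕ} (σ : ℝ) {Ω : Type*} [MeasurableSpace Ω] (P : Measure Ω)
    (X : Ω → Fin n → ℝ) (Z : Ω → Fin n → EuclideanSpace ℝ (Fin d)) (Y : Ω → Fin n → ℝ)
    (α : ℝ) : ℝ :=
  P.real {ω | zq (1 - α / 2) * (σ * √(gramInv (X ω) (Z ω) (Sum.inl ()) (Sum.inl ()))) <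
    |olsCoef (X ω) (Z ω) (Y ω)|}

/-! ### Asymptotic power -/

/-- A sequence of tests whose one-sided and two-sided level-`α` versions have powers `powOne n α`
and `powTwo n α` has asymptotic power equal to that of a `z`-test with standardized effect
size `μ`. -/
def HasZTestPower (powOne powTwo : ℕ → ℝ → ℝ) (μ : ℝ) : Prop :=
  ∀ α : ℝ, 0 < α → α < 1 →
    Tendsto (fun n => powOne n α) atTop (𝓝 (Phi (μ - zq (1 - α)))) ∧
    Tendsto (fun n => powTwo n α) atTop
      (𝓝 (Phi (μ - zq (1 - α / 2)) + Phi (-μ - zq (1 - α / 2))))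

end CRT

end

/-!
Write `Q` for the projection `1 - Z (Zᵀ Z)⁻¹ Zᵀ` and `r = Xᵀ Q X`. Almost surely `Zᵀ Z` is
invertible (`ae_isUnit_det_gram`), so by the Frisch–Waugh–Lovell formula (`olsCoef_eq_div`)
`β̂ = Xᵀ Q Y / r = β + Xᵀ Q ε / r`, while the first diagonal entry of `([X, Z]ᵀ [X, Z])⁻¹` is `1 / r`.
As the noise is independent of the design, `N = Xᵀ Q ε / (σ √r)` is exactly standard normal
(`IsLinearModel.exists_standard_normal`). Hence the standardized estimate `β̂ √r / σ` equals
`(h / σ) √(r / n) + N`. Since `Q Z = 0`, `r` is a quadratic form in a standard Gaussian vector with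
a projection of trace `n - d`, where `d` is the number of confounders, and Chebyshev's inequality
(`stdNormal_quadForm_le`) gives `r / n → 1 - κ`. This settles the fixed-`X` tests, whose critical
value for the standardized estimate is a normal quantile.

For the conditional randomization test only the cutoff has to be found. Given `Z` and `Y`, the
resampled coefficient is `‖Q Y‖ N' / r'`, with `N'` standard normal and `r' / n → 1 - κ` again, and
`‖Q Y‖² / n → σ² (1 - κ)` because `β → 0`. So `√n` times the cutoff converges in probability to the
normal quantile times `σ / √(1 - κ)` (`tendsto_crtCutoff`), and on the scale of the standardized
estimate the critical value has the same limit as that of the fixed-`X` test.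

Convergence in probability is expressed by a filter `whp l P` on the disjoint union of the sample
spaces. As `l` may be any filter, it can itself be of the form `whp atTop P`: the conditional laws of
the resampled covariate are indexed by the outcomes of the sample, and limits under them hold with
high probability over the sample. The one-sided and two-sided tests are treated together, through a
function `f` which is the identity or the absolute value (`IsSided`).
-/

namespace CRT

/-! ### Convergence with high probability -/

section Whp

variable {ι : Type*} {Ω : ι → Type*} [∀ i, MeasurableSpace (Ω i)]

/-- The filter, on the disjoint union of a family of measure spaces, of the events whose complement
has measure tending to `0` along `l`. For probability measures, `Tendsto A (whp l P) (𝓝 a)` is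
convergence in probability of the random variables `fun ω => A ⟨i, ω⟩` to `a`; the events need not
be measurable, as `P i` is taken as an outer measure. -/
def whp (l : Filter ι) (P : ∀ i, Measure (Ω i)) : Filter (Σ i, Ω i) where
  sets := {s | Tendsto (fun i => P i {ω | (⟨i, ω⟩ : Σ i, Ω i) ∉ s}) l (𝓝 0)}
  univ_sets := by simpa using tendsto_const_nhds
  sets_of_superset {s t} hs hst :=
    tendsto_of_tendsto_of_tendsto_of_le_of_le tendsto_const_nhds hs (fun _ => zero_le)
      fun i => measure_mono fun ω hω h => hω (hst h)
  inter_sets {s t} hs ht := by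
    have h := Tendsto.add (Set.mem_ofPred_eq ▸ hs) (Set.mem_ofPred_eq ▸ ht)
    rw [add_zero] at h
    refine tendsto_of_tendsto_of_tendsto_of_le_of_le tendsto_const_nhds h (fun _ => zero_le)
      fun i => ?_
    refine (measure_mono fun ω hω => ?_).trans (measure_union_le _ _)
    by_contra hc
    simp only [Set.mem_union, Set.mem_ofPred_eq, not_or, not_not] at hc
    exact hω hc

variable {l : Filter ι} {P : ∀ i, Measure (Ω i)}

lemma eventually_whp {p : (Σ i, Ω i) → Prop} :
    (∀ᶠ x in whp l P, p x) ↔ Tendsto (fun i => P i {ω | ¬ p ⟨i, ω⟩}) l (𝓝 0) :=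
  Iff.rfl

lemma tendsto_fst_whp : Tendsto Sigma.fst (whp l P) l := by
  intro s hs
  refine eventually_whp.2 (tendsto_const_nhds.congr' ?_)
  filter_upwards [hs] with i hi
  simp [hi]

lemma eventually_whp_of_ae {p : (Σ i, Ω i) → Prop}
    (h : ∀ᶠ i in l, ∀ᵐ ω ∂P i, p ⟨i, ω⟩) : ∀ᶠ x in whp l P, p x :=
  eventually_whp.2 <| tendsto_const_nhds.congr' <| h.mono fun _ hi => (ae_iff.1 hi).symm

/-- Slutsky's lemma: if `H` is close to `f ∘ N` with high probability, and the law of `N` does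
not charge the boundary `{f = 0}`, then the probability of `{0 ≤ H}`, and of any event between
`{0 < H}` and `{0 ≤ H}`, converges to that of `{0 ≤ f ∘ N}`. -/
lemma tendsto_measureReal_of_whp [∀ i, IsProbabilityMeasure (P i)] {ν : Measure ℝ}
    [IsProbabilityMeasure ν] {N : ∀ i, Ω i → ℝ} (hN : ∀ᶠ i in l, HasLaw (N i) ν (P i))
    {f : ℝ → ℝ} (hf : Measurable f) (hf0 : ν {x | f x = 0} = 0)
    {H : (Σ i, Ω i) → ℝ} (hH : Tendsto (fun x => H x - f (N x.1 x.2)) (whp l P) (𝓝 0))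
    {E : ∀ i, Set (Ω i)}
    (hE : ∀ᶠ x in whp l P, (0 < H x → x.2 ∈ E x.1) ∧ (x.2 ∈ E x.1 → 0 ≤ H x)) :
    Tendsto (fun i => (P i).real (E i)) l (𝓝 (ν.real {x | 0 ≤ f x})) := by
  have hbad : ∀ δ > 0, Tendsto (fun i => (P i).real
      {ω | ¬ ((|H ⟨i, ω⟩ - f (N i ω)| < δ) ∧ (0 < H ⟨i, ω⟩ → ω ∈ E i) ∧
        (ω ∈ E i → 0 ≤ H ⟨i, ω⟩))}) l (𝓝 0) := by
    intro δ hδ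
    have h1 : ∀ᶠ x in whp l P, |H x - f (N x.1 x.2)| < δ := by
      simpa [Real.dist_eq] using (Metric.tendsto_nhds.1 hH δ hδ)
    have h2 := (ENNReal.tendsto_toReal ENNReal.zero_ne_top).comp (eventually_whp.1 (h1.and hE))
    exact h2
  have hlaw : ∀ s : Set ℝ, MeasurableSet s → ∀ᶠ i in l, (P i).real (N i ⁻¹' s) = ν.real s := by
    intro s hs
    filter_upwards [hN] with i hi
    rw [measureReal_def, measureReal_def, ← hi.map_eq,
      Measure.map_apply_of_aemeasurable hi.aemeasurable hs]
  have hu : Tendsto (fun k : ℕ => 1 / ((k : ℝ) + 1)) atTop (𝓝 0) :=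
    tendsto_one_div_add_atTop_nhds_zero_nat
  have hpos : ∀ k : ℕ, 0 < 1 / ((k : ℝ) + 1) := fun k => by positivity
  have hanti : Antitone fun k : ℕ => 1 / ((k : ℝ) + 1) := fun a b hab =>
    Nat.one_div_le_one_div hab
  have heq : ν.real {x | 0 < f x} = ν.real {x | 0 ≤ f x} := by
    refine measureReal_congr ?_
    have : ∀ᵐ x ∂ν, f x ≠ 0 := by simpa [ae_iff] using hf0
    filter_upwards [this] with x hx
    exact propext (lt_iff_le_and_ne.trans ⟨fun h => h.1, fun h => ⟨h, hx.symm⟩⟩)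
  refine tendsto_order.2 ⟨fun a ha => ?_, fun a ha => ?_⟩
  · have hlim : Tendsto (fun k : ℕ => ν.real {x | 1 / ((k : ℝ) + 1) ≤ f x}) atTop
        (𝓝 (ν.real {x | 0 < f x})) := by
      have := tendsto_measure_iUnion_atTop (μ := ν)
        (s := fun k : ℕ => {x | 1 / ((k : ℝ) + 1) ≤ f x})
        (fun a b hab x hx => (hanti hab).trans hx)
      have hU : ⋃ k : ℕ, {x | 1 / ((k : ℝ) + 1) ≤ f x} = {x | 0 < f x} := by
        ext x
        simp only [Set.mem_iUnion, Set.mem_ofPred_eq]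
        refine ⟨fun ⟨k, hk⟩ => (hpos k).trans_le hk, fun hx => ?_⟩
        obtain ⟨k, hk⟩ := exists_nat_one_div_lt hx
        exact ⟨k, hk.le⟩
      rw [hU] at this
      exact (ENNReal.tendsto_toReal (measure_ne_top _ _)).comp this
    obtain ⟨k, hk⟩ := (hlim.eventually (lt_mem_nhds (heq ▸ ha))).exists
    filter_upwards [hlaw {x | 1 / ((k : ℝ) + 1) ≤ f x} (measurableSet_le measurable_const hf),
      (hbad _ (hpos k)).eventually (gt_mem_nhds (sub_pos.2 hk))] with i h1 h2
    have hsub : N i ⁻¹' {x | 1 / ((k : ℝ) + 1) ≤ f x} ⊆ E i ∪ {ω | ¬ ((|H ⟨i, ω⟩ - f (N i ω)| <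
        1 / ((k : ℝ) + 1)) ∧ (0 < H ⟨i, ω⟩ → ω ∈ E i) ∧ (ω ∈ E i → 0 ≤ H ⟨i, ω⟩))} := by
      intro ω hω
      by_contra hc
      simp only [Set.mem_union, Set.mem_ofPred_eq, not_or, not_not] at hc
      have h3 := (abs_lt.1 hc.2.1).1
      have h4 : 1 / ((k : ℝ) + 1) ≤ f (N i ω) := hω
      exact hc.1 (hc.2.2.1 (by linarith))
    have h3 := (measureReal_mono (μ := P i) hsub).trans (measureReal_union_le _ _)
    linarith
  · have hlim : Tendsto (fun k : ℕ => ν.real {x | -(1 / ((k : ℝ) + 1)) ≤ f x}) atTop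
        (𝓝 (ν.real {x | 0 ≤ f x})) := by
      have := tendsto_measure_iInter_atTop (μ := ν)
        (s := fun k : ℕ => {x | -(1 / ((k : ℝ) + 1)) ≤ f x})
        (fun k => (measurableSet_le measurable_const hf).nullMeasurableSet)
        (fun a b hab x hx => (neg_le_neg (hanti hab)).trans hx) ⟨0, measure_ne_top _ _⟩
      have hU : ⋂ k : ℕ, {x | -(1 / ((k : ℝ) + 1)) ≤ f x} = {x | 0 ≤ f x} := by
        ext x
        simp only [Set.mem_iInter, Set.mem_ofPred_eq]
        refine ⟨fun h => ?_, fun hx k => by linarith [hpos k]⟩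
        exact le_of_tendsto' (by simpa using hu.neg) h
      rw [hU] at this
      exact (ENNReal.tendsto_toReal (measure_ne_top _ _)).comp this
    obtain ⟨k, hk⟩ := (hlim.eventually (gt_mem_nhds ha)).exists
    filter_upwards [hlaw {x | -(1 / ((k : ℝ) + 1)) ≤ f x} (measurableSet_le measurable_const hf),
      (hbad _ (hpos k)).eventually (gt_mem_nhds (sub_pos.2 hk))] with i h1 h2
    have hsub : E i ⊆ N i ⁻¹' {x | -(1 / ((k : ℝ) + 1)) ≤ f x} ∪ {ω | ¬ ((|H ⟨i, ω⟩ - f (N i ω)| <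
        1 / ((k : ℝ) + 1)) ∧ (0 < H ⟨i, ω⟩ → ω ∈ E i) ∧ (ω ∈ E i → 0 ≤ H ⟨i, ω⟩))} := by
      intro ω hω
      by_contra hc
      simp only [Set.mem_union, Set.mem_ofPred_eq, not_or, not_not, Set.mem_preimage] at hc
      have h3 := (abs_lt.1 hc.2.1).2
      have h4 := hc.2.2.2 hω
      exact hc.1 (by linarith)
    have h3 := (measureReal_mono (μ := P i) hsub).trans (measureReal_union_le _ _)
    linarith

end Whp

/-! ### Quantiles -/

/-- Convergence of rescaled quantiles from the convergence of distribution functions. -/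
lemma tendsto_mul_sInf_of_quantile {ι : Type*} {l : Filter ι} {F : ι → ℝ → ℝ}
    (hF : ∀ i, Monotone (F i)) {b : ι → ℝ} (hb : ∀ᶠ i in l, 0 < b i) {a q : ℝ}
    (hgt : ∀ t, q < t → ∀ᶠ i in l, a ≤ F i (t / b i))
    (hlt : ∀ t, t < q → ∀ᶠ i in l, F i (t / b i) < a) :
    Tendsto (fun i => b i * sInf {t | a ≤ F i t}) l (𝓝 q) := by
  have key : ∀ i, 0 < b i → ∀ t₁ t₂, F i (t₁ / b i) < a → a ≤ F i (t₂ / b i) →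
      t₁ ≤ b i * sInf {t | a ≤ F i t} ∧ b i * sInf {t | a ≤ F i t} ≤ t₂ := by
    intro i hi t₁ t₂ h₁ h₂
    have hlow : ∀ t ∈ {t | a ≤ F i t}, t₁ / b i ≤ t := by
      intro t ht
      by_contra! hc
      exact absurd ((hF i hc.le).trans_lt h₁) (not_lt.2 ht)
    constructor
    · rw [← div_le_iff₀' hi]
      exact le_csInf ⟨_, h₂⟩ hlow
    · rw [← le_div_iff₀' hi]
      exact csInf_le ⟨_, hlow⟩ h₂
  refine tendsto_order.2 ⟨fun c hc => ?_, fun c hc => ?_⟩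
  · obtain ⟨t, hct, htq⟩ := exists_between hc
    filter_upwards [hb, hlt t htq, hgt (q + 1) (by linarith)] with i h1 h2 h3
    exact hct.trans_le (key i h1 _ _ h2 h3).1
  · obtain ⟨t, hqt, htc⟩ := exists_between hc
    filter_upwards [hb, hgt t hqt, hlt (q - 1) (by linarith)] with i h1 h2 h3
    exact (key i h1 _ _ h3 h2).2.trans_lt htc

/-- The transformations `f` of an estimate whose large values a test detects: `f = id` for a
one-sided test and `f = |·|` for a two-sided one. -/
structure IsSided (f : ℝ → ℝ) : Prop where
  lipschitz : ∀ x y, |f x - f y| ≤ |x - y|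
  map_mul : ∀ c x, 0 ≤ c → f (c * x) = c * f x
  countable : ∀ t, {x | f x = t}.Countable

lemma isSided_id : IsSided fun x => x where
  lipschitz _ _ := le_rfl
  map_mul _ _ _ := rfl
  countable t := by simp

lemma isSided_abs : IsSided fun x => |x| where
  lipschitz x y := abs_abs_sub_abs_le x y
  map_mul c x hc := by rw [abs_mul, abs_of_nonneg hc]
  countable t := by
    refine Set.Finite.countable ((Set.toFinite {t, -t}).subset fun x hx => ?_)
    simp only [Set.mem_ofPred_eq] at hx
    rcases abs_choice x with h | h <;> rw [h] at hx <;> simp [← hx]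

lemma IsSided.measurable {f : ℝ → ℝ} (hf : IsSided f) : Measurable f :=
  (LipschitzWith.of_dist_le_mul (K := 1) fun x y => by
    simpa [Real.dist_eq] using hf.lipschitz x y).continuous.measurable

section Limits

variable {ι : Type*} {Ω : ι → Type*} [∀ i, MeasurableSpace (Ω i)] {l : Filter ι}
  {P : ∀ i, Measure (Ω i)} [∀ i, IsProbabilityMeasure (P i)] {N : ∀ i, Ω i → ℝ} {f : ℝ → ℝ}

/-- The limiting rejection probability of a test with an asymptotically normal statistic
`M + N` and a random critical value `A`. -/
lemma tendsto_power (hN : ∀ᶠ i in l, HasLaw (N i) (gaussianReal 0 1) (P i)) (hf : IsSided f)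
    {M A : (Σ i, Ω i) → ℝ} {m q : ℝ} (hM : Tendsto M (whp l P) (𝓝 m))
    (hA : Tendsto A (whp l P) (𝓝 q)) {E : ∀ i, Set (Ω i)}
    (hE : ∀ᶠ x in whp l P, (A x < f (M x + N x.1 x.2) → x.2 ∈ E x.1) ∧
      (x.2 ∈ E x.1 → A x ≤ f (M x + N x.1 x.2))) :
    Tendsto (fun i => (P i).real (E i)) l (𝓝 ((gaussianReal 0 1).real {x | q ≤ f (m + x)})) := by
  have : NullSingletonClass (gaussianReal 0 1) := nullSingletonClass_gaussianReal one_ne_zero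
  have h := tendsto_measureReal_of_whp (ν := gaussianReal 0 1) hN
    (f := fun x => f (m + x) - q) (H := fun x => f (M x + N x.1 x.2) - A x) (E := E)
    ((hf.measurable.comp (measurable_const_add m)).sub_const q) ?_ ?_ ?_
  · simpa only [sub_nonneg] using h
  · refine Set.Countable.measure_zero ?_ _
    simp only [sub_eq_zero]
    exact (hf.countable q).preimage (add_right_injective m)
  · have h0 : Tendsto (fun x => |M x - m| + |A x - q|) (whp l P) (𝓝 0) := by
      simpa using ((hM.sub_const m).abs.add (hA.sub_const q).abs)
    refine squeeze_zero_norm (fun x => ?_) h0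
    have h1 := hf.lipschitz (M x + N x.1 x.2) (m + N x.1 x.2)
    rw [add_sub_add_right_eq_sub] at h1
    have : f (M x + N x.1 x.2) - A x - (f (m + N x.1 x.2) - q) =
      (f (M x + N x.1 x.2) - f (m + N x.1 x.2)) - (A x - q) := by ring
    rw [Real.norm_eq_abs, this]
    exact (abs_sub _ _).trans (by gcongr)
  · simpa only [sub_pos, sub_nonneg] using hE

/-- The limit of the rescaled quantiles of a statistic `T` with `b T ≈ s f(N)` for a standard
normal `N`. -/
lemma tendsto_mul_quantile (hN : ∀ᶠ i in l, HasLaw (N i) (gaussianReal 0 1) (P i))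
    (hf : IsSided f) {V T : (Σ i, Ω i) → ℝ} {b : ι → ℝ} {s q a : ℝ} (hs : 0 < s)
    (hb : ∀ᶠ i in l, 0 < b i) (hV : Tendsto V (whp l P) (𝓝 s))
    (hT : ∀ᶠ x in whp l P, b x.1 * T x = V x * f (N x.1 x.2))
    (hgt : ∀ t, q < t → a < (gaussianReal 0 1).real {x | f x ≤ t})
    (hlt : ∀ t, t < q → (gaussianReal 0 1).real {x | f x ≤ t} < a) :
    Tendsto (fun i => b i * sInf {t | a ≤ (P i).real {ω | T ⟨i, ω⟩ ≤ t}}) l (𝓝 (s * q)) := by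
  have : NullSingletonClass (gaussianReal 0 1) := nullSingletonClass_gaussianReal one_ne_zero
  have key : ∀ t, Tendsto (fun i => (P i).real {ω | T ⟨i, ω⟩ ≤ t / b i}) l
      (𝓝 ((gaussianReal 0 1).real {x | f x ≤ t / s})) := by
    intro t
    have h := tendsto_measureReal_of_whp (ν := gaussianReal 0 1) hN
      (f := fun x => t / s - f x) (H := fun x => t / V x - f (N x.1 x.2))
      (E := fun i => {ω | T ⟨i, ω⟩ ≤ t / b i})
      (measurable_const.sub hf.measurable) ?_ ?_ ?_
    · simpa only [sub_nonneg] using h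
    · refine Set.Countable.measure_zero ?_ _
      simp only [sub_eq_zero, eq_comm (a := t / s)]
      exact hf.countable _
    · have h1 : Tendsto (fun x => t / V x - t / s) (whp l P) (𝓝 0) := by
        simpa using ((tendsto_const_nhds.div hV hs.ne').sub_const (t / s) :
          Tendsto (fun x => t / V x - t / s) (whp l P) _)
      exact h1.congr fun x => by ring
    · filter_upwards [hT, hV.eventually (lt_mem_nhds hs), tendsto_fst_whp.eventually hb]
        with x h1 h2 h3
      have : x.2 ∈ {ω | T ⟨x.1, ω⟩ ≤ t / b x.1} ↔ f (N x.1 x.2) ≤ t / V x := by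
        simp only [Set.mem_ofPred_eq]
        rw [le_div_iff₀' h3, le_div_iff₀' h2, h1]
      exact ⟨fun h => this.2 (sub_pos.1 h).le, fun h => sub_nonneg.2 (this.1 h)⟩
  have hmono : ∀ i, Monotone fun t => (P i).real {ω | T ⟨i, ω⟩ ≤ t} := fun i t₁ t₂ h =>
    measureReal_mono fun ω (hω : T ⟨i, ω⟩ ≤ t₁) => hω.trans h
  refine tendsto_mul_sInf_of_quantile hmono hb (fun t ht => ?_) (fun t ht => ?_)
  · filter_upwards [(key t).eventually (lt_mem_nhds (hgt _ ((lt_div_iff₀' hs).2 ht)))] with i hi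
    exact hi.le
  · exact (key t).eventually (gt_mem_nhds (hlt _ ((div_lt_iff₀' hs).2 ht)))

end Limits

/-! ### Least squares through the residual projection -/

section Residual

variable {n d : ℕ}

/-- The `n × d` matrix of confounders with rows `z i`. -/
def rowMatrix (z : Fin n → EuclideanSpace ℝ (Fin d)) : Matrix (Fin n) (Fin d) ℝ :=
  Matrix.of fun i j => z i j

/-- The matrix `1 - z (zᵀ z)⁻¹ zᵀ` of the orthogonal projection onto the complement of the column
space of `z`. If `zᵀ z` is singular, its matrix inverse is `0` and this is the identity matrix,
which is still a symmetric idempotent. -/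
noncomputable def residual (z : Fin n → EuclideanSpace ℝ (Fin d)) : Matrix (Fin n) (Fin n) ℝ :=
  1 - rowMatrix z * ((rowMatrix z)ᵀ * rowMatrix z)⁻¹ * (rowMatrix z)ᵀ

variable (z : Fin n → EuclideanSpace ℝ (Fin d))

lemma residual_transpose : (residual z)ᵀ = residual z := by
  simp [residual, Matrix.transpose_sub, Matrix.transpose_mul, Matrix.transpose_nonsing_inv,
    Matrix.mul_assoc]

variable {z}

lemma residual_mul_rowMatrix (h : IsUnit ((rowMatrix z)ᵀ * rowMatrix z).det) :
    residual z * rowMatrix z = 0 := by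
  rw [residual, Matrix.sub_mul, Matrix.one_mul, Matrix.mul_assoc, Matrix.mul_assoc,
    Matrix.nonsing_inv_mul _ h, Matrix.mul_one, sub_self]

variable (z) in
lemma residual_mul_self : residual z * residual z = residual z := by
  by_cases h : IsUnit ((rowMatrix z)ᵀ * rowMatrix z).det
  · conv_lhs => enter [2]; rw [residual]
    rw [Matrix.mul_sub, Matrix.mul_one, Matrix.mul_assoc (rowMatrix z), ← Matrix.mul_assoc,
      residual_mul_rowMatrix h, Matrix.zero_mul, sub_zero]
  · simp [residual, Matrix.nonsing_inv_apply_not_isUnit _ h]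

lemma trace_residual (h : IsUnit ((rowMatrix z)ᵀ * rowMatrix z).det) :
    (residual z).trace = n - d := by
  rw [residual, Matrix.trace_sub, Matrix.trace_mul_comm, ← Matrix.mul_assoc,
    Matrix.mul_nonsing_inv _ h]
  simp

variable (z) in
lemma dotProduct_residual_mulVec_comm (x y : Fin n → ℝ) :
    x ⬝ᵥ (residual z *ᵥ y) = (residual z *ᵥ x) ⬝ᵥ y := by
  rw [Matrix.dotProduct_mulVec, ← Matrix.mulVec_transpose, residual_transpose]

variable (z) in
lemma dotProduct_residual_mulVec_self (x : Fin n → ℝ) :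
    x ⬝ᵥ (residual z *ᵥ x) = (residual z *ᵥ x) ⬝ᵥ (residual z *ᵥ x) := by
  rw [← dotProduct_residual_mulVec_comm, Matrix.mulVec_mulVec, residual_mul_self]

lemma residual_mulVec_rowMatrix (h : IsUnit ((rowMatrix z)ᵀ * rowMatrix z).det) (v : Fin d → ℝ) :
    residual z *ᵥ (rowMatrix z *ᵥ v) = 0 := by
  rw [Matrix.mulVec_mulVec, residual_mul_rowMatrix h, Matrix.zero_mulVec]

/-- The first row of the inverse Gram matrix, by the Schur complement of the block `zᵀ z`, which is
the residual sum of squares `xᵀ Q x`. -/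
lemma gramInv_first_row (h : IsUnit ((rowMatrix z)ᵀ * rowMatrix z).det) {x : Fin n → ℝ}
    (hx : x ⬝ᵥ (residual z *ᵥ x) ≠ 0) :
    gramInv x z (.inl ()) (.inl ()) = (x ⬝ᵥ (residual z *ᵥ x))⁻¹ ∧
    ∀ j, gramInv x z (.inl ()) (.inr j) = -((x ⬝ᵥ (residual z *ᵥ x))⁻¹ *
      (x ᵥ* (rowMatrix z * ((rowMatrix z)ᵀ * rowMatrix z)⁻¹)) j) := by
  set A := Matrix.replicateCol Unit x with hA
  set D := (rowMatrix z)ᵀ * rowMatrix z with hD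
  have hgram : (design x z)ᵀ * design x z =
      Matrix.fromBlocks (Aᵀ * A) (Aᵀ * rowMatrix z) ((rowMatrix z)ᵀ * A) D := by
    change (Matrix.fromCols A (rowMatrix z))ᵀ * Matrix.fromCols A (rowMatrix z) = _
    rw [Matrix.transpose_fromCols, Matrix.fromRows_mul_fromCols]
  let : Invertible D := Matrix.invertibleOfIsUnitDet _ h
  have hschur : Aᵀ * A - Aᵀ * rowMatrix z * ⅟D * ((rowMatrix z)ᵀ * A) =
      Matrix.of fun _ _ => x ⬝ᵥ (residual z *ᵥ x) := by
    have : Aᵀ * A - Aᵀ * rowMatrix z * ⅟D * ((rowMatrix z)ᵀ * A) = Aᵀ * (residual z * A) := by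
      rw [residual, Matrix.invOf_eq_nonsing_inv, Matrix.sub_mul, Matrix.mul_sub, Matrix.one_mul]
      simp only [Matrix.mul_assoc, hD]
    rw [this]
    ext i j
    simp [Matrix.mul_apply, hA, dotProduct, Matrix.mulVec]
  set s := x ⬝ᵥ (residual z *ᵥ x) with hs
  let B : Matrix Unit Unit ℝ := Matrix.of fun _ _ => s⁻¹
  have hB : B * (Aᵀ * A - Aᵀ * rowMatrix z * ⅟D * ((rowMatrix z)ᵀ * A)) = 1 := by
    rw [hschur]
    ext i j
    simp [B, Matrix.mul_apply, hx]
  let hinv : Invertible (Aᵀ * A - Aᵀ * rowMatrix z * ⅟D * ((rowMatrix z)ᵀ * A)) :=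
    invertibleOfLeftInverse _ B hB
  have hBi : ⅟(Aᵀ * A - Aᵀ * rowMatrix z * ⅟D * ((rowMatrix z)ᵀ * A)) = B :=
    invOf_eq_left_inv hB
  let := Matrix.fromBlocks₂₂Invertible (Aᵀ * A) (Aᵀ * rowMatrix z) ((rowMatrix z)ᵀ * A) D
  have hgi : gramInv x z = ⅟(Matrix.fromBlocks (Aᵀ * A) (Aᵀ * rowMatrix z)
      ((rowMatrix z)ᵀ * A) D) := by
    rw [gramInv, hgram, Matrix.invOf_eq_nonsing_inv]
  rw [hgi, Matrix.invOf_fromBlocks₂₂_eq, hBi]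
  refine ⟨rfl, fun j => ?_⟩
  rw [Matrix.fromBlocks_apply₁₂, Matrix.neg_apply, Matrix.mul_assoc, Matrix.mul_assoc,
    Matrix.invOf_eq_nonsing_inv]
  simp [B, Matrix.mul_apply, Matrix.vecMul, dotProduct, hA]

lemma gramInv_inl_inl (h : IsUnit ((rowMatrix z)ᵀ * rowMatrix z).det) {x : Fin n → ℝ}
    (hx : x ⬝ᵥ (residual z *ᵥ x) ≠ 0) :
    gramInv x z (.inl ()) (.inl ()) = (x ⬝ᵥ (residual z *ᵥ x))⁻¹ :=
  (gramInv_first_row h hx).1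

/-- The Frisch–Waugh–Lovell formula for the coefficient of `x`. -/
lemma olsCoef_eq_div (h : IsUnit ((rowMatrix z)ᵀ * rowMatrix z).det) {x : Fin n → ℝ}
    (hx : x ⬝ᵥ (residual z *ᵥ x) ≠ 0) (y : Fin n → ℝ) :
    olsCoef x z y = x ⬝ᵥ (residual z *ᵥ y) / (x ⬝ᵥ (residual z *ᵥ x)) := by
  obtain ⟨h1, h2⟩ := gramInv_first_row h hx
  have hl : ((design x z)ᵀ *ᵥ y) (.inl ()) = x ⬝ᵥ y := by
    simp [design, Matrix.mulVec, dotProduct]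
  have hr : ∀ j, ((design x z)ᵀ *ᵥ y) (.inr j) = ((rowMatrix z)ᵀ *ᵥ y) j := by
    intro j
    simp [design, Matrix.mulVec, dotProduct, rowMatrix]
  have hsum : ∀ s : ℝ, ∑ j, -(s * (x ᵥ* (rowMatrix z * ((rowMatrix z)ᵀ * rowMatrix z)⁻¹)) j) *
      ((rowMatrix z)ᵀ *ᵥ y) j = -(s * ((x ᵥ* (rowMatrix z * ((rowMatrix z)ᵀ * rowMatrix z)⁻¹)) ⬝ᵥ
      ((rowMatrix z)ᵀ *ᵥ y))) := by
    intro s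
    rw [dotProduct, Finset.mul_sum, ← Finset.sum_neg_distrib]
    exact Finset.sum_congr rfl fun j _ => by ring
  have hdot : (x ᵥ* (rowMatrix z * ((rowMatrix z)ᵀ * rowMatrix z)⁻¹)) ⬝ᵥ ((rowMatrix z)ᵀ *ᵥ y) =
      x ⬝ᵥ y - x ⬝ᵥ (residual z *ᵥ y) := by
    rw [← Matrix.dotProduct_mulVec, Matrix.mulVec_mulVec, residual, Matrix.sub_mulVec,
      dotProduct_sub, Matrix.one_mulVec, sub_sub_cancel]
  rw [olsCoef, Matrix.mulVec, dotProduct, Fintype.sum_sum_type]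
  simp only [Finset.univ_unique, PUnit.default_eq_unit, Finset.sum_singleton, hl, hr, h1, h2]
  rw [hsum, hdot]
  ring

lemma measurable_residual_apply (i j : Fin n) :
    Measurable fun z : Fin n → EuclideanSpace ℝ (Fin d) => residual z i j := by
  have hc : Continuous fun z : Fin n → EuclideanSpace ℝ (Fin d) => rowMatrix z :=
    continuous_matrix fun i j => by simp only [rowMatrix, Matrix.of_apply]; fun_prop
  have hg : Continuous fun z : Fin n → EuclideanSpace ℝ (Fin d) =>
    (rowMatrix z)ᵀ * rowMatrix z := hc.matrix_transpose.matrix_mul hc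
  have hd := hg.matrix_det.measurable.inv
  have ha : ∀ k l, Measurable fun z : Fin n → EuclideanSpace ℝ (Fin d) =>
      ((rowMatrix z)ᵀ * rowMatrix z)⁻¹ k l := by
    intro k l
    simp only [Matrix.inv_def, Matrix.smul_apply, smul_eq_mul, Ring.inverse_eq_inv']
    exact hd.mul (hg.matrix_adjugate.matrix_elem k l).measurable
  simp only [residual, Matrix.sub_apply, Matrix.mul_apply, Matrix.transpose_apply]
  refine measurable_const.sub (Finset.measurable_sum _ fun k _ => Measurable.mul
    (Finset.measurable_sum _ fun l _ => Measurable.mul ?_ (ha l k)) ?_)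
  · exact (hc.matrix_elem i l).measurable
  · exact (hc.matrix_elem j k).measurable

end Residual

/-! ### Standard Gaussian vectors -/

section Gaussian

variable {n d : ℕ}

/-- The law `N(0, I)` on `Fin n → ℝ`. -/
noncomputable abbrev stdNormal (n : ℕ) : Measure (Fin n → ℝ) :=
  Measure.pi fun _ => gaussianReal 0 1

lemma map_dotProduct_stdNormal {u : Fin n → ℝ} (hu : u ⬝ᵥ u = 1) :
    (stdNormal n).map (fun w => u ⬝ᵥ w) = gaussianReal 0 1 := by
  let L : StrongDual ℝ (EuclideanSpace ℝ (Fin n)) := innerSL ℝ (WithLp.toLp 2 u)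
  have hL : ∀ w : Fin n → ℝ, u ⬝ᵥ w = L (WithLp.toLp 2 w) := by
    intro w
    simp [L, PiLp.inner_apply, dotProduct, mul_comm]
  have hnorm : ‖L‖ ^ 2 = 1 := by
    rw [innerSL_apply_norm, EuclideanSpace.real_norm_sq_eq, ← hu]
    simp [dotProduct, sq]
  have : (fun w : Fin n → ℝ => u ⬝ᵥ w) = L ∘ WithLp.toLp 2 := funext hL
  rw [this, ← Measure.map_map (by fun_prop) (by fun_prop), map_pi_eq_stdGaussian,
    IsGaussian.map_eq_gaussianReal, integral_strongDual_stdGaussian, variance_dual_stdGaussian,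
    hnorm, Real.toNNReal_one]

lemma integral_sq_gaussianReal : ∫ x, x ^ 2 ∂gaussianReal 0 1 = 1 := by
  have h := variance_id_gaussianReal (μ := 0) (v := 1)
  rw [variance_of_integral_eq_zero (by fun_prop) (by simp)] at h
  simpa using h

lemma memLp_sq_gaussianReal : MemLp (fun x : ℝ => x ^ 2) 2 (gaussianReal 0 1) := by
  have h := memLp_id_gaussianReal (μ := 0) (v := 1) 4
  have h2 := h.norm_rpow_div 2
  have h4 : ((4 : NNReal) : ENNReal) / 2 = 2 := by
    rw [show ((4 : NNReal) : ENNReal) = 2 * 2 by norm_num]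
    exact ENNReal.mul_div_cancel_right two_ne_zero ENNReal.ofNat_ne_top
  rw [h4] at h2
  simpa using h2

/-- Diagonalization of a quadratic form in a standard Gaussian vector. -/
lemma stdNormal_quadForm_eq {A : Matrix (Fin n) (Fin n) ℝ} (hA : A.IsHermitian) {s : Set ℝ}
    (hs : MeasurableSet s) :
    stdNormal n {w | w ⬝ᵥ (A *ᵥ w) ∈ s} =
      stdNormal n {v | ∑ i, hA.eigenvalues i * v i ^ 2 ∈ s} := by
  let b := hA.eigenvectorBasis
  let q : EuclideanSpace ℝ (Fin n) → ℝ := fun x => (x : Fin n → ℝ) ⬝ᵥ (A *ᵥ (x : Fin n → ℝ))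
  have hq : Measurable q := by
    simp only [q, dotProduct, Matrix.mulVec]
    fun_prop
  have hqb : ∀ v : Fin n → ℝ, q (∑ i, v i • b i) = ∑ i, hA.eigenvalues i * v i ^ 2 := by
    intro v
    have h1 : A *ᵥ ((∑ i, v i • b i : EuclideanSpace ℝ (Fin n)) : Fin n → ℝ) =
        ((∑ i, (hA.eigenvalues i * v i) • b i : EuclideanSpace ℝ (Fin n)) : Fin n → ℝ) := by
      simp only [WithLp.ofLp_sum, WithLp.ofLp_smul, Matrix.mulVec_sum, Matrix.mulVec_smul]
      refine Finset.sum_congr rfl fun i _ => ?_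
      rw [hA.mulVec_eigenvectorBasis, smul_smul, mul_comm]
    simp only [q]
    rw [h1]
    have h2 : ∀ x y : EuclideanSpace ℝ (Fin n), (x : Fin n → ℝ) ⬝ᵥ (y : Fin n → ℝ) =
        inner ℝ x y := by
      intro x y
      simp [PiLp.inner_apply, dotProduct, mul_comm]
    rw [h2, sum_inner]
    refine Finset.sum_congr rfl fun i _ => ?_
    rw [real_inner_smul_left, b.orthonormal.inner_right_fintype]
    ring
  have h1 : stdNormal n {w | w ⬝ᵥ (A *ᵥ w) ∈ s} =
      stdGaussian (EuclideanSpace ℝ (Fin n)) (q ⁻¹' s) := by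
    rw [← map_pi_eq_stdGaussian, Measure.map_apply (by fun_prop) (hq hs)]
    rfl
  rw [h1, stdGaussian_eq_map_pi_orthonormalBasis b, Measure.map_apply (by fun_prop) (hq hs)]
  congr 1
  ext v
  simp [hqb]

/-- Chebyshev's inequality for `wᵀ A w`, with `A` an orthogonal projection and `w` standard
Gaussian: a rotation turns the form into a sum of `trace A` independent squares. -/
lemma stdNormal_quadForm_le {A : Matrix (Fin n) (Fin n) ℝ} (hAt : Aᵀ = A) (hAA : A * A = A)
    {c : ℝ} (hc : 0 < c) :
    stdNormal n {w | c ≤ |w ⬝ᵥ (A *ᵥ w) - A.trace|} ≤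
      ENNReal.ofReal (n * Var[fun x => x ^ 2; gaussianReal 0 1] / c ^ 2) := by
  have hA : A.IsHermitian := by
    rw [Matrix.IsHermitian, Matrix.conjTranspose_eq_transpose_of_trivial, hAt]
  have hlam : ∀ i, hA.eigenvalues i ^ 2 = hA.eigenvalues i := by
    intro i
    have h1 := hA.mulVec_eigenvectorBasis i
    have h2 : A *ᵥ (A *ᵥ ⇑(hA.eigenvectorBasis i)) = A *ᵥ ⇑(hA.eigenvectorBasis i) := by
      rw [Matrix.mulVec_mulVec, hAA]
    rw [h1, Matrix.mulVec_smul, h1, smul_smul, ← sq] at h2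
    have hne : (⇑(hA.eigenvectorBasis i) : Fin n → ℝ) ≠ 0 := by
      intro h0
      refine hA.eigenvectorBasis.orthonormal.ne_zero i ?_
      ext j
      exact congrFun h0 j
    exact smul_left_injective ℝ hne h2
  have htr : A.trace = ∑ i, hA.eigenvalues i := by
    simpa using hA.trace_eq_sum_eigenvalues
  have hmem : ∀ i, MemLp (fun x : ℝ => hA.eigenvalues i * x ^ 2) 2 (gaussianReal 0 1) :=
    fun i => memLp_sq_gaussianReal.const_mul _
  have hmem' : ∀ i, MemLp (fun v : Fin n → ℝ => hA.eigenvalues i * v i ^ 2) 2 (stdNormal n) :=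
    fun i => (hmem i).comp_measurePreserving (measurePreserving_eval _ i)
  have hint : ∫ v, ∑ i, hA.eigenvalues i * v i ^ 2 ∂stdNormal n = A.trace := by
    rw [integral_finsetSum _ fun i _ => (hmem' i).integrable one_le_two, htr]
    refine Finset.sum_congr rfl fun i _ => ?_
    have h := (measurePreserving_eval (fun _ : Fin n => gaussianReal 0 1) i).map_eq
    have h3 : ∫ v : Fin n → ℝ, hA.eigenvalues i * v i ^ 2 ∂stdNormal n =
        ∫ x, hA.eigenvalues i * x ^ 2 ∂(stdNormal n).map (Function.eval i) := by
      rw [integral_map (measurable_pi_apply i).aemeasurable (by fun_prop)]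
    rw [h3, h, integral_const_mul, integral_sq_gaussianReal, mul_one]
  have hvar : Var[fun v => ∑ i, hA.eigenvalues i * v i ^ 2; stdNormal n] ≤
      n * Var[fun x => x ^ 2; gaussianReal 0 1] := by
    have h := variance_sum_pi (μ := fun _ : Fin n => gaussianReal 0 1)
      (X := fun i x => hA.eigenvalues i * x ^ 2) hmem
    have h2 : (∑ i, fun v : Fin n → ℝ => hA.eigenvalues i * v i ^ 2) =
      fun v => ∑ i, hA.eigenvalues i * v i ^ 2 := by ext v; simp
    rw [← h2, h]
    have h3 : ∀ i ∈ Finset.univ, Var[fun x => hA.eigenvalues i * x ^ 2; gaussianReal 0 1] ≤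
        Var[fun x => x ^ 2; gaussianReal 0 1] := by
      intro i _
      rw [variance_const_mul, hlam]
      refine mul_le_of_le_one_left (variance_nonneg _ _) ?_
      nlinarith [hlam i, sq_nonneg (hA.eigenvalues i - 1)]
    simpa using Finset.sum_le_card_nsmul _ _ _ h3
  have hs : MeasurableSet {x : ℝ | c ≤ |x - A.trace|} :=
    measurableSet_le measurable_const (by fun_prop)
  have h := stdNormal_quadForm_eq hA hs
  have hcheb := meas_ge_le_variance_div_sq (memLp_finsetSum Finset.univ fun i _ => hmem' i) hc
  simp only [hint] at hcheb
  simp only [Set.mem_ofPred_eq] at h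
  rw [h]
  refine hcheb.trans (ENNReal.ofReal_le_ofReal ?_)
  gcongr

/-! ### The confounder matrix has full column rank almost surely -/

/-- A nondegenerate Gaussian vector does not charge proper subspaces. -/
lemma multivariateGaussian_submodule_eq_zero {S : Matrix (Fin d) (Fin d) ℝ} (hS : S.PosDef)
    {V : Submodule ℝ (EuclideanSpace ℝ (Fin d))} (hV : V ≠ ⊤) :
    multivariateGaussian 0 S (V : Set (EuclideanSpace ℝ (Fin d))) = 0 := by
  obtain ⟨v, hv, hv0⟩ : ∃ v ∈ Vᗮ, v ≠ 0 := by
    by_contra! h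
    exact hV ((Submodule.orthogonal_eq_bot_iff).1 ((Submodule.eq_bot_iff _).2 h))
  let L : StrongDual ℝ (EuclideanSpace ℝ (Fin d)) := innerSL ℝ v
  have hvar : Var[L; multivariateGaussian 0 S] = (v : Fin d → ℝ) ⬝ᵥ (S *ᵥ (v : Fin d → ℝ)) := by
    rw [← covarianceBilin_multivariateGaussian (μ := 0) hS.posSemidef,
      covarianceBilin_apply_eq_cov IsGaussian.memLp_two_id, covariance_self (by fun_prop)]
    rfl
  have hpos : 0 < Var[L; multivariateGaussian 0 S] := by
    rw [hvar]
    have h0 : (v : Fin d → ℝ) ≠ 0 := by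
      intro h
      exact hv0 (by ext j; exact congrFun h j)
    simpa using hS.dotProduct_mulVec_pos h0
  have hmap := IsGaussian.map_eq_gaussianReal (μ := multivariateGaussian 0 S) L
  have hna : NullSingletonClass (gaussianReal (∫ x, L x ∂multivariateGaussian 0 S)
      (Var[L; multivariateGaussian 0 S]).toNNReal) :=
    nullSingletonClass_gaussianReal (Real.toNNReal_pos.2 hpos).ne'
  refine measure_mono_null (t := L ⁻¹' {0}) (fun x hx => ?_) ?_
  · simpa [L, real_inner_comm] using (Submodule.mem_orthogonal _ _).1 hv x hx
  · rw [← Measure.map_apply (by fun_prop) (measurableSet_singleton _), hmap]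
    exact measure_singleton _

/-- Row by row: each new row avoids the span of the previous ones, a proper subspace. -/
lemma ae_linearIndependent {S : Matrix (Fin d) (Fin d) ℝ} (hS : S.PosDef) :
    ∀ {k : ℕ}, k ≤ d → ∀ᵐ z ∂Measure.pi fun _ : Fin k => multivariateGaussian 0 S,
      LinearIndependent ℝ z
  | 0, _ => ae_of_all _ fun _ => linearIndependent_empty_type
  | k + 1, hk => by
    have ih := ae_linearIndependent hS (k := k) (by omega)
    have hmp := measurePreserving_piFinSuccAbove
      (fun _ : Fin (k + 1) => multivariateGaussian 0 S) 0
    have hms : MeasurableSet {z : Fin (k + 1) → EuclideanSpace ℝ (Fin d) |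
        LinearIndependent ℝ z} := isOpen_setOfPred_linearIndependent.measurableSet
    rw [← hmp.symm.map_eq, ae_map_iff (by fun_prop) hms]
    have hms' : MeasurableSet {q : EuclideanSpace ℝ (Fin d) × (Fin k → EuclideanSpace ℝ (Fin d)) |
        LinearIndependent ℝ (Fin.cons q.1 q.2 : Fin (k + 1) → EuclideanSpace ℝ (Fin d))} := by
      refine hms.preimage (measurable_pi_lambda _ fun i => ?_)
      refine Fin.cases ?_ (fun j => ?_) i
      · exact measurable_fst
      · exact (measurable_pi_apply j).comp measurable_snd
    -- In this order of integration the new row is drawn last, given the others.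
    have hswap : ∀ᵐ q ∂(multivariateGaussian 0 S).prod
        (Measure.pi fun _ : Fin k => multivariateGaussian 0 S),
        LinearIndependent ℝ (Fin.cons q.1 q.2 : Fin (k + 1) → EuclideanSpace ℝ (Fin d)) := by
      rw [← Measure.prod_swap, ae_map_iff (by fun_prop) hms']
      refine (Measure.ae_prod_iff_ae_ae (measurable_swap hms')).2 ?_
      filter_upwards [ih] with v hv
      have hspan : Submodule.span ℝ (Set.range v) ≠ ⊤ := by
        intro h
        have h1 := finrank_span_eq_card hv
        rw [h, finrank_top, finrank_euclideanSpace_fin, Fintype.card_fin] at h1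
        omega
      have h0 := multivariateGaussian_submodule_eq_zero hS hspan
      filter_upwards [measure_eq_zero_iff_ae_notMem.1 h0] with x hx
      exact hv.finCons hx
    filter_upwards [hswap] with q hq
    simpa [MeasurableEquiv.piFinSuccAbove, Fin.insertNthEquiv] using hq

/-- For at least as many rows as columns, the Gaussian matrix `z` has full column rank: already
its first `d` rows are linearly independent. -/
lemma ae_isUnit_det_gram {S : Matrix (Fin d) (Fin d) ℝ} (hS : S.PosDef) (hdn : d ≤ n) :
    ∀ᵐ z ∂Measure.pi fun _ : Fin n => multivariateGaussian 0 S,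
      IsUnit ((rowMatrix z)ᵀ * rowMatrix z).det := by
  have hmap : (Measure.pi fun _ : Fin n => multivariateGaussian 0 S).map
      (fun z i => z (Fin.castLE hdn i)) =
      Measure.pi fun _ : Fin d => multivariateGaussian 0 S := by
    have h := iIndepFun_pi (μ := fun _ : Fin n => multivariateGaussian 0 S)
      (X := fun _ x => x) fun _ => aemeasurable_id
    have h2 := h.precomp (Fin.castLE_injective hdn)
    rw [iIndepFun_iff_map_fun_eq_pi_map (fun i => (measurable_pi_apply _).aemeasurable)] at h2
    rw [h2]
    congr 1
    ext i : 1
    exact (measurePreserving_eval (fun _ : Fin n => multivariateGaussian 0 S) _).map_eq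
  have hli := ae_linearIndependent hS le_rfl
  rw [← hmap] at hli
  filter_upwards [ae_of_ae_map
    (measurable_pi_lambda _ fun i => measurable_pi_apply _).aemeasurable hli] with z hz
  have hspan : Submodule.span ℝ (Set.range fun i => z (Fin.castLE hdn i)) = ⊤ :=
    hz.span_eq_top_of_card_eq_finrank' (by simp)
  rw [isUnit_iff_ne_zero, ne_eq, ← Matrix.exists_mulVec_eq_zero_iff]
  rintro ⟨v, hv0, hv⟩
  have hzv : rowMatrix z *ᵥ v = 0 := by
    rw [← Matrix.mulVec_mulVec] at hv
    have : (rowMatrix z *ᵥ v) ⬝ᵥ (rowMatrix z *ᵥ v) = 0 := by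
      rw [Matrix.dotProduct_mulVec, ← Matrix.mulVec_transpose, hv, zero_dotProduct]
    exact dotProduct_self_eq_zero.1 this
  have hin : ∀ x : EuclideanSpace ℝ (Fin d), inner ℝ (WithLp.toLp 2 v) x = (0 : ℝ) := by
    intro x
    have hx : x ∈ Submodule.span ℝ (Set.range fun i => z (Fin.castLE hdn i)) :=
      hspan ▸ Submodule.mem_top
    induction hx using Submodule.span_induction with
    | mem x hx =>
      obtain ⟨i, rfl⟩ := hx
      have := congrFun hzv (Fin.castLE hdn i)
      simpa [Matrix.mulVec, dotProduct, rowMatrix, PiLp.inner_apply] using this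
    | zero => simp
    | add x y _ _ hx hy => rw [inner_add_right, hx, hy, add_zero]
    | smul a x _ hx => rw [real_inner_smul_right, hx, mul_zero]
  have := inner_self_eq_zero.1 (hin (WithLp.toLp 2 v))
  exact hv0 (by simpa using this)

end Gaussian

/-! ### The standard normal distribution function -/

section Phi

lemma real_gaussianReal_Ici (t : ℝ) : (gaussianReal 0 1).real (Set.Ici t) = Phi (-t) := by
  have h : (gaussianReal 0 1).map (fun x => -x) = gaussianReal 0 1 := by
    rw [gaussianReal_map_neg, neg_zero]
  rw [Phi, measureReal_def, measureReal_def, ← h,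
    Measure.map_apply measurable_neg measurableSet_Ici, h]
  congr 2
  ext x
  simp

lemma real_gaussianReal_Ioi (t : ℝ) : (gaussianReal 0 1).real (Set.Ioi t) = 1 - Phi t := by
  rw [← Set.compl_Iic, probReal_compl_eq_one_sub measurableSet_Iic, Phi]

lemma Phi_neg (t : ℝ) : Phi (-t) = 1 - Phi t := by
  have : NullSingletonClass (gaussianReal 0 1) := nullSingletonClass_gaussianReal one_ne_zero
  rw [← real_gaussianReal_Ici, ← real_gaussianReal_Ioi]
  exact measureReal_congr Ioi_ae_eq_Ici.symm

lemma Phi_zero : Phi 0 = 1 / 2 := by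
  have := Phi_neg 0
  rw [neg_zero] at this
  linarith

lemma strictMono_Phi : StrictMono Phi := by
  intro s t hst
  have h1 : Phi t = Phi s + (gaussianReal 0 1).real (Set.Ioc s t) := by
    rw [Phi, Phi, ← measureReal_union (Set.Iic_disjoint_Ioc le_rfl) measurableSet_Ioc,
      Set.Iic_union_Ioc_eq_Iic hst.le]
  have h2 : gaussianReal 0 1 (Set.Ioc s t) ≠ 0 := by
    intro h0
    have := gaussianReal_absolutelyContinuous' 0 one_ne_zero h0
    simp only [Real.volume_Ioc, ENNReal.ofReal_eq_zero, sub_nonpos] at this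
    exact absurd hst (not_lt.2 this)
  have h3 : 0 < (gaussianReal 0 1).real (Set.Ioc s t) := ENNReal.toReal_pos h2 (measure_ne_top _ _)
  linarith

lemma exists_le_Phi {a : ℝ} (ha : a < 1) : ∃ t, a ≤ Phi t := by
  have h := tendsto_cdf_atTop (gaussianReal 0 1)
  obtain ⟨t, ht⟩ := (h.eventually (lt_mem_nhds ha)).exists
  rw [cdf_eq_real] at ht
  exact ⟨t, ht.le⟩

lemma exists_Phi_lt {a : ℝ} (ha : 0 < a) : ∃ t, Phi t < a := by
  have h := tendsto_cdf_atBot (gaussianReal 0 1)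
  obtain ⟨t, ht⟩ := (h.eventually (gt_mem_nhds ha)).exists
  rw [cdf_eq_real] at ht
  exact ⟨t, ht⟩

lemma lt_Phi_of_zq_lt {a t : ℝ} (ha : a < 1) (ht : zq a < t) : a < Phi t := by
  obtain ⟨s, hs, hst⟩ := exists_lt_of_csInf_lt (exists_le_Phi ha) ht
  exact lt_of_le_of_lt hs (strictMono_Phi hst)

lemma Phi_lt_of_lt_zq {a t : ℝ} (ha : 0 < a) (ht : t < zq a) : Phi t < a := by
  by_contra! h
  obtain ⟨b, hb⟩ := exists_Phi_lt ha
  have hbdd : BddBelow {t : ℝ | a ≤ (gaussianReal 0 1).real (Set.Iic t)} :=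
    ⟨b, fun s hs => (strictMono_Phi.lt_iff_lt.1 (hb.trans_le hs)).le⟩
  exact absurd (csInf_le hbdd h) (not_le.2 ht)

lemma zq_nonneg {a : ℝ} (ha : 1 / 2 ≤ a) (ha1 : a < 1) : 0 ≤ zq a := by
  by_contra! h
  have := lt_Phi_of_zq_lt ha1 h
  rw [Phi_zero] at this
  linarith

lemma real_gaussianReal_abs_le {t : ℝ} (ht : 0 ≤ t) :
    (gaussianReal 0 1).real {x | |x| ≤ t} = 2 * Phi t - 1 := by
  have : NullSingletonClass (gaussianReal 0 1) := nullSingletonClass_gaussianReal one_ne_zero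
  have h1 : {x : ℝ | |x| ≤ t} = Set.Icc (-t) t := by ext x; simp [abs_le]
  have h2 : Phi t = Phi (-t) + (gaussianReal 0 1).real (Set.Ioc (-t) t) := by
    rw [Phi, Phi, ← measureReal_union (Set.Iic_disjoint_Ioc le_rfl) measurableSet_Ioc,
      Set.Iic_union_Ioc_eq_Iic (by linarith)]
  rw [h1, ← measureReal_congr (Ioc_ae_eq_Icc (a := -t) (b := t) (μ := gaussianReal 0 1))]
  linarith [Phi_neg t]

lemma real_gaussianReal_le_add (q m : ℝ) :
    (gaussianReal 0 1).real {x | q ≤ m + x} = Phi (m - q) := by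
  have h : {x : ℝ | q ≤ m + x} = Set.Ici (q - m) := by
    ext x; simp [add_comm]
  rw [h, real_gaussianReal_Ici, neg_sub]

lemma real_gaussianReal_le_abs_add {q : ℝ} (hq : 0 ≤ q) (m : ℝ) :
    (gaussianReal 0 1).real {x | q ≤ |m + x|} = Phi (m - q) + Phi (-m - q) := by
  have : NullSingletonClass (gaussianReal 0 1) := nullSingletonClass_gaussianReal one_ne_zero
  have h : {x : ℝ | q ≤ |m + x|} = Set.Iic (-m - q) ∪ Set.Ici (q - m) := by
    ext x
    simp only [Set.mem_ofPred_eq, le_abs, Set.mem_union, Set.mem_Iic, Set.mem_Ici]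
    rw [or_comm]
    exact or_congr ⟨fun h => by linarith, fun h => by linarith⟩
      ⟨fun h => by linarith, fun h => by linarith⟩
  have h2 : (gaussianReal 0 1).real (Set.Iic (-m - q) ∪ Set.Ici (q - m)) =
      (gaussianReal 0 1).real (Set.Iic (-m - q) ∪ Set.Ioi (q - m)) :=
    measureReal_congr ((ae_eq_refl _).union Ioi_ae_eq_Ici.symm)
  have hd : Disjoint (Set.Iic (-m - q)) (Set.Ioi (q - m)) :=
    Set.Iic_disjoint_Ioi (by linarith)
  rw [h, h2, measureReal_union hd measurableSet_Ioi, real_gaussianReal_Ioi, ← Phi_neg, neg_sub,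
    add_comm]
  rfl

end Phi

/-! ### The linear model at a fixed sample size -/

section Model

variable {n d : ℕ}

lemma covariateKernel_apply (ξ : Fin d → ℝ) (z : Fin n → EuclideanSpace ℝ (Fin d)) :
    covariateKernel ξ z = (stdNormal n).map fun w => w + rowMatrix z *ᵥ ξ := by
  have h := Measure.pi_map_pi (μ := fun _ : Fin n => gaussianReal 0 1)
    (f := fun i x => x + ∑ j, z i j * ξ j) (fun i => by fun_prop)
  have h2 : (fun w : Fin n → ℝ => w + rowMatrix z *ᵥ ξ) =
      fun w i => w i + ∑ j, z i j * ξ j := by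
    ext w i
    simp [Matrix.mulVec, dotProduct, rowMatrix]
  rw [h2, h]
  simp only [gaussianReal_map_add_const, zero_add]
  rfl

lemma measurable_residual_mulVec :
    Measurable fun q : (Fin n → EuclideanSpace ℝ (Fin d)) × (Fin n → ℝ) =>
      residual q.1 *ᵥ q.2 := by
  refine measurable_pi_lambda _ fun i => ?_
  simp only [Matrix.mulVec, dotProduct]
  refine Finset.measurable_sum _ fun j _ => Measurable.mul ?_ ?_
  · exact (measurable_residual_apply i j).comp measurable_fst
  · exact (measurable_pi_apply j).comp measurable_snd

lemma measurable_dotProduct_residual :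
    Measurable fun q : (Fin n → EuclideanSpace ℝ (Fin d)) × (Fin n → ℝ) =>
      q.2 ⬝ᵥ (residual q.1 *ᵥ q.2) :=
  Finset.measurable_sum _ fun i _ => Measurable.mul
    ((measurable_pi_apply i).comp measurable_snd)
    ((measurable_pi_apply i).comp measurable_residual_mulVec)

lemma stdNormal_residual_quadForm_le {z : Fin n → EuclideanSpace ℝ (Fin d)}
    (hz : IsUnit ((rowMatrix z)ᵀ * rowMatrix z).det) {c : ℝ} (hc : 0 < c) :
    stdNormal n {w | c ≤ |w ⬝ᵥ (residual z *ᵥ w) - (n - d)|} ≤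
      ENNReal.ofReal (n * Var[fun x => x ^ 2; gaussianReal 0 1] / c ^ 2) := by
  rw [← trace_residual hz]
  exact stdNormal_quadForm_le (residual_transpose z) (residual_mul_self z) hc

/-- Under the conditional law of the covariate, its residual sum of squares concentrates around
the residual degrees of freedom `n - d`. -/
lemma covariateKernel_quadForm_le (ξ : Fin d → ℝ) {z : Fin n → EuclideanSpace ℝ (Fin d)}
    (hz : IsUnit ((rowMatrix z)ᵀ * rowMatrix z).det) {c : ℝ} (hc : 0 < c) :
    covariateKernel ξ z {x | c ≤ |x ⬝ᵥ (residual z *ᵥ x) - (n - d)|} ≤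
      ENNReal.ofReal (n * Var[fun x => x ^ 2; gaussianReal 0 1] / c ^ 2) := by
  have hm : Measurable fun x : Fin n → ℝ => x ⬝ᵥ (residual z *ᵥ x) :=
    measurable_dotProduct_residual.comp measurable_prodMk_left
  rw [covariateKernel_apply, Measure.map_apply (by fun_prop)
    (measurableSet_le measurable_const (by fun_prop))]
  have : ∀ w : Fin n → ℝ, (w + rowMatrix z *ᵥ ξ) ⬝ᵥ (residual z *ᵥ (w + rowMatrix z *ᵥ ξ)) =
      w ⬝ᵥ (residual z *ᵥ w) := by
    intro w
    rw [dotProduct_residual_mulVec_self, Matrix.mulVec_add, residual_mulVec_rowMatrix hz, add_zero,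
      ← dotProduct_residual_mulVec_self]
  simp only [Set.preimage_ofPred_eq, this]
  exact stdNormal_residual_quadForm_le hz hc

lemma hasLaw_covariateKernel (ξ : Fin d → ℝ) {z : Fin n → EuclideanSpace ℝ (Fin d)}
    (hz : IsUnit ((rowMatrix z)ᵀ * rowMatrix z).det) {y : Fin n → ℝ}
    (hy : 0 < y ⬝ᵥ (residual z *ᵥ y)) :
    HasLaw (fun x => (√(y ⬝ᵥ (residual z *ᵥ y)))⁻¹ * x ⬝ᵥ (residual z *ᵥ y)) (gaussianReal 0 1)
      (covariateKernel ξ z) := by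
  have hm : Measurable fun x : Fin n → ℝ =>
      (√(y ⬝ᵥ (residual z *ᵥ y)))⁻¹ * x ⬝ᵥ (residual z *ᵥ y) := by
    simp only [dotProduct]
    fun_prop
  refine ⟨hm.aemeasurable, ?_⟩
  set u := (√(y ⬝ᵥ (residual z *ᵥ y)))⁻¹ • (residual z *ᵥ y) with hu
  have huu : u ⬝ᵥ u = 1 := by
    rw [hu, smul_dotProduct, dotProduct_smul, ← dotProduct_residual_mulVec_self, smul_smul,
      ← mul_inv, Real.mul_self_sqrt hy.le, smul_eq_mul, inv_mul_cancel₀ hy.ne']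
  rw [covariateKernel_apply, Measure.map_map hm (by fun_prop), ← map_dotProduct_stdNormal huu]
  congr 1
  ext w
  rw [Function.comp_apply, add_dotProduct, dotProduct_residual_mulVec_comm z (rowMatrix z *ᵥ ξ),
    residual_mulVec_rowMatrix hz, zero_dotProduct, add_zero, hu, smul_dotProduct, smul_eq_mul,
    dotProduct_comm w]

/-- A random unit vector projects an independent standard Gaussian vector to a standard normal
variable. -/
lemma hasLaw_dotProduct_of_indepFun {Ω 𝓤 : Type*} [MeasurableSpace Ω] [MeasurableSpace 𝓤]
    {P : Measure Ω} [IsProbabilityMeasure P] {U : Ω → 𝓤} {G : Ω → Fin n → ℝ}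
    (hU : AEMeasurable U P) (hG : HasLaw G (stdNormal n) P) (hi : IndepFun U G P)
    {e : 𝓤 → Fin n → ℝ} (he : Measurable e) (hee : ∀ u, e u ⬝ᵥ e u = 1) :
    HasLaw (fun ω => e (U ω) ⬝ᵥ G ω) (gaussianReal 0 1) P := by
  have hmeas : Measurable fun q : 𝓤 × (Fin n → ℝ) => e q.1 ⬝ᵥ q.2 :=
    Finset.measurable_sum _ fun i _ => Measurable.mul
      ((measurable_pi_apply i).comp (he.comp measurable_fst))
      ((measurable_pi_apply i).comp measurable_snd)
  refine ⟨hmeas.comp_aemeasurable (hU.prodMk hG.aemeasurable), ?_⟩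
  have : IsProbabilityMeasure (P.map U) := Measure.isProbabilityMeasure_map hU
  have h1 : P.map (fun ω => e (U ω) ⬝ᵥ G ω) =
      ((P.map U).prod (stdNormal n)).map fun q => e q.1 ⬝ᵥ q.2 := by
    rw [← hG.map_eq, ← hi.map_prod_eq_prod_map_map hU hG.aemeasurable,
      AEMeasurable.map_map_of_aemeasurable hmeas.aemeasurable (hU.prodMk hG.aemeasurable)]
    rfl
  rw [h1]
  ext s hs
  rw [Measure.map_apply hmeas hs, Measure.prod_apply (hmeas hs)]
  have h2 : ∀ u, stdNormal n (Prod.mk u ⁻¹' ((fun q : 𝓤 × (Fin n → ℝ) => e q.1 ⬝ᵥ q.2) ⁻¹' s)) =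
      gaussianReal 0 1 s := by
    intro u
    have hmu : Measurable fun w : Fin n → ℝ => e u ⬝ᵥ w := hmeas.comp measurable_prodMk_left
    rw [← map_dotProduct_stdNormal (hee u), Measure.map_apply hmu hs]
    rfl
  simp [h2]

/-- A measurable choice of a unit vector in the direction of the residual of `x`. Where the residual
vanishes it is an arbitrary fixed unit vector. -/
lemma exists_measurable_unit_residual (hn : 0 < n) :
    ∃ e : (Fin n → EuclideanSpace ℝ (Fin d)) × (Fin n → ℝ) → Fin n → ℝ, Measurable e ∧
      (∀ q, e q ⬝ᵥ e q = 1) ∧ ∀ q, 0 < q.2 ⬝ᵥ (residual q.1 *ᵥ q.2) →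
        e q = (√(q.2 ⬝ᵥ (residual q.1 *ᵥ q.2)))⁻¹ • (residual q.1 *ᵥ q.2) := by
  classical
  have hset : MeasurableSet {q : (Fin n → EuclideanSpace ℝ (Fin d)) × (Fin n → ℝ) |
      0 < q.2 ⬝ᵥ (residual q.1 *ᵥ q.2)} :=
    measurableSet_lt measurable_const measurable_dotProduct_residual
  refine ⟨fun q => if 0 < q.2 ⬝ᵥ (residual q.1 *ᵥ q.2) then
      (√(q.2 ⬝ᵥ (residual q.1 *ᵥ q.2)))⁻¹ • (residual q.1 *ᵥ q.2) else Pi.single ⟨0, hn⟩ 1,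
    Measurable.ite hset ?_ measurable_const, fun q => ?_, fun q hq => if_pos hq⟩
  · exact measurable_dotProduct_residual.sqrt.inv.smul measurable_residual_mulVec
  · by_cases hq : 0 < q.2 ⬝ᵥ (residual q.1 *ᵥ q.2)
    · simp only [if_pos hq]
      rw [smul_dotProduct, dotProduct_smul, ← dotProduct_residual_mulVec_self, smul_smul,
        ← mul_inv, Real.mul_self_sqrt hq.le, smul_eq_mul, inv_mul_cancel₀ hq.ne']
    · simp [if_neg hq]

variable {S : Matrix (Fin d) (Fin d) ℝ} {ξ θ : Fin d → ℝ} {β σ : ℝ} {Ω : Type*}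
  [MeasurableSpace Ω] {P : Measure Ω} {X : Ω → Fin n → ℝ}
  {Z : Ω → Fin n → EuclideanSpace ℝ (Fin d)} {ε Y : Ω → Fin n → ℝ}

namespace IsLinearModel

lemma ae_isUnit (hM : IsLinearModel S ξ θ β σ P X Z ε Y) (hS : S.PosDef) (hdn : d ≤ n) :
    ∀ᵐ ω ∂P, IsUnit ((rowMatrix (Z ω))ᵀ * rowMatrix (Z ω)).det := by
  have h := ae_isUnit_det_gram (n := n) hS hdn
  rw [← hM.law_Z.map_eq] at h
  exact ae_of_ae_map hM.law_Z.aemeasurable h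

/-- A bound on a conditional probability given the confounders is a bound on the probability. -/
lemma measure_le_of_forall_isUnit [IsProbabilityMeasure P]
    (hM : IsLinearModel S ξ θ β σ P X Z ε Y) (hS : S.PosDef)
    (hdn : d ≤ n) {V : Ω → Fin n → ℝ}
    {K : Kernel (Fin n → EuclideanSpace ℝ (Fin d)) (Fin n → ℝ)} [IsMarkovKernel K]
    (hV : HasCondDistrib V Z K P)
    {s : Set ((Fin n → EuclideanSpace ℝ (Fin d)) × (Fin n → ℝ))} (hs : MeasurableSet s)
    {b : ENNReal}
    (hb : ∀ z, IsUnit ((rowMatrix z)ᵀ * rowMatrix z).det → K z (Prod.mk z ⁻¹' s) ≤ b) :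
    P {ω | (Z ω, V ω) ∈ s} ≤ b := by
  have h1 : P {ω | (Z ω, V ω) ∈ s} = (P.map Z ⊗ₘ K) s := by
    rw [← hV.map_eq, Measure.map_apply_of_aemeasurable hV.aemeasurable hs]
    rfl
  have : IsProbabilityMeasure (P.map Z) :=
    Measure.isProbabilityMeasure_map hM.law_Z.aemeasurable
  rw [h1, Measure.compProd_apply hs]
  have h := ae_isUnit_det_gram (n := n) hS hdn
  rw [← hM.law_Z.map_eq] at h
  calc ∫⁻ z, K z (Prod.mk z ⁻¹' s) ∂P.map Z ≤ ∫⁻ _, b ∂P.map Z :=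
        lintegral_mono_ae (h.mono hb)
    _ = b := by simp

lemma measurableSet_quadForm (c a : ℝ) :
    MeasurableSet {q : (Fin n → EuclideanSpace ℝ (Fin d)) × (Fin n → ℝ) |
      c ≤ |q.2 ⬝ᵥ (residual q.1 *ᵥ q.2) - a|} :=
  measurableSet_le measurable_const (measurable_dotProduct_residual.sub_const a).abs

lemma covariate_quadForm_le [IsProbabilityMeasure P]
    (hM : IsLinearModel S ξ θ β σ P X Z ε Y) (hS : S.PosDef)
    (hdn : d ≤ n) {c : ℝ} (hc : 0 < c) :
    P {ω | c ≤ |X ω ⬝ᵥ (residual (Z ω) *ᵥ X ω) - (n - d)|} ≤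
      ENNReal.ofReal (n * Var[fun x => x ^ 2; gaussianReal 0 1] / c ^ 2) :=
  hM.measure_le_of_forall_isUnit hS hdn hM.law_X (measurableSet_quadForm c (n - d))
    fun _ hz => covariateKernel_quadForm_le ξ hz hc

lemma hasLaw_scaled_noise (hM : IsLinearModel S ξ θ β σ P X Z ε Y) (hσ : 0 < σ) :
    HasLaw (fun ω => σ⁻¹ • ε ω) (stdNormal n) P := by
  have hε := hM.law_noise.aemeasurable
  refine ⟨by fun_prop, ?_⟩
  have h : P.map (fun ω => σ⁻¹ • ε ω) = (P.map ε).map fun v i => σ⁻¹ * v i := by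
    rw [AEMeasurable.map_map_of_aemeasurable (measurable_pi_lambda _ fun i =>
      (measurable_pi_apply i).const_mul σ⁻¹).aemeasurable hε]
    rfl
  rw [h, hM.law_noise.map_eq, Measure.pi_map_pi (fun i => by fun_prop)]
  simp only [gaussianReal_map_const_mul, mul_zero]
  congr 1
  ext i : 1
  congr 1
  ext
  simp only [NNReal.coe_mul, NNReal.coe_mk, Real.coe_toNNReal _ (sq_nonneg σ), NNReal.coe_one]
  field_simp

lemma indep_scaled_noise (hM : IsLinearModel S ξ θ β σ P X Z ε Y) :
    IndepFun (fun ω => (X ω, Z ω)) (fun ω => σ⁻¹ • ε ω) P :=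
  hM.indep.comp measurable_id (measurable_const_smul σ⁻¹)

lemma noise_quadForm_le [IsProbabilityMeasure P]
    (hM : IsLinearModel S ξ θ β σ P X Z ε Y) (hS : S.PosDef) (hσ : 0 < σ)
    (hdn : d ≤ n) {c : ℝ} (hc : 0 < c) :
    P {ω | c ≤ |(σ⁻¹ • ε ω) ⬝ᵥ (residual (Z ω) *ᵥ (σ⁻¹ • ε ω)) - (n - d)|} ≤
      ENNReal.ofReal (n * Var[fun x => x ^ 2; gaussianReal 0 1] / c ^ 2) := by
  have hlaw := hM.hasLaw_scaled_noise hσ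
  have hcond : HasCondDistrib (fun ω => σ⁻¹ • ε ω) Z (Kernel.const _ (stdNormal n)) P := by
    refine ⟨hM.law_Z.aemeasurable.prodMk hlaw.aemeasurable, ?_⟩
    have hi : IndepFun Z (fun ω => σ⁻¹ • ε ω) P :=
      hM.indep_scaled_noise.comp measurable_snd measurable_id
    have : IsProbabilityMeasure (P.map Z) :=
      Measure.isProbabilityMeasure_map hM.law_Z.aemeasurable
    rw [Measure.compProd_const, hi.map_prod_eq_prod_map_map hM.law_Z.aemeasurable
      hlaw.aemeasurable, hlaw.map_eq]
  exact hM.measure_le_of_forall_isUnit hS hdn hcond (measurableSet_quadForm c (n - d))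
    fun _ hz => stdNormal_residual_quadForm_le hz hc

/-- The standardized inner product of the noise with the residual of the covariate is exactly
standard normal, as the noise is independent of the design. -/
lemma exists_standard_normal [IsProbabilityMeasure P]
    (hM : IsLinearModel S ξ θ β σ P X Z ε Y) (hσ : 0 < σ) (hn : 0 < n) :
    ∃ N : Ω → ℝ, HasLaw N (gaussianReal 0 1) P ∧
      ∀ ω, 0 < X ω ⬝ᵥ (residual (Z ω) *ᵥ X ω) →
        X ω ⬝ᵥ (residual (Z ω) *ᵥ ε ω) = σ * √(X ω ⬝ᵥ (residual (Z ω) *ᵥ X ω)) * N ω := by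
  obtain ⟨e, he, hee, hq⟩ := exists_measurable_unit_residual (d := d) hn
  have hZX : AEMeasurable (fun ω => (Z ω, X ω)) P :=
    hM.law_Z.aemeasurable.prodMk hM.law_X.aemeasurable_snd
  have hi : IndepFun (fun ω => (Z ω, X ω)) (fun ω => σ⁻¹ • ε ω) P :=
    (hM.indep_scaled_noise (σ := σ)).comp measurable_swap measurable_id
  refine ⟨fun ω => e (Z ω, X ω) ⬝ᵥ (σ⁻¹ • ε ω),
    hasLaw_dotProduct_of_indepFun hZX (hM.hasLaw_scaled_noise hσ) hi he hee, fun ω hω => ?_⟩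
  have h1 : √(X ω ⬝ᵥ (residual (Z ω) *ᵥ X ω)) ≠ 0 := (Real.sqrt_pos.2 hω).ne'
  beta_reduce
  rw [dotProduct_residual_mulVec_comm, hq (Z ω, X ω) hω, smul_dotProduct, dotProduct_smul,
    smul_eq_mul, smul_eq_mul]
  field_simp

lemma residual_mulVec_response (hM : IsLinearModel S ξ θ β σ P X Z ε Y) {ω : Ω}
    (hω : IsUnit ((rowMatrix (Z ω))ᵀ * rowMatrix (Z ω)).det) :
    residual (Z ω) *ᵥ Y ω = β • (residual (Z ω) *ᵥ X ω) + residual (Z ω) *ᵥ ε ω := by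
  have : Y ω = β • X ω + rowMatrix (Z ω) *ᵥ θ + ε ω := by
    ext i
    simp [hM.response, Matrix.mulVec, dotProduct, rowMatrix, mul_comm]
  rw [this, Matrix.mulVec_add, Matrix.mulVec_add, Matrix.mulVec_smul,
    residual_mulVec_rowMatrix hω, add_zero]

lemma olsCoef_eq_add (hM : IsLinearModel S ξ θ β σ P X Z ε Y) {ω : Ω}
    (hω : IsUnit ((rowMatrix (Z ω))ᵀ * rowMatrix (Z ω)).det)
    (hr : 0 < X ω ⬝ᵥ (residual (Z ω) *ᵥ X ω)) :
    olsCoef (X ω) (Z ω) (Y ω) =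
      β + X ω ⬝ᵥ (residual (Z ω) *ᵥ ε ω) / (X ω ⬝ᵥ (residual (Z ω) *ᵥ X ω)) := by
  rw [olsCoef_eq_div hω hr.ne', hM.residual_mulVec_response hω, dotProduct_add, dotProduct_smul,
    smul_eq_mul, add_div, mul_div_cancel_right₀ _ hr.ne']

/-- The residual sum of squares of the response is close to that of the noise for small `β`. -/
lemma abs_response_quadForm_sub_le (hM : IsLinearModel S ξ θ β σ P X Z ε Y) {ω : Ω}
    (hω : IsUnit ((rowMatrix (Z ω))ᵀ * rowMatrix (Z ω)).det) (hβ : 0 ≤ β) :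
    |Y ω ⬝ᵥ (residual (Z ω) *ᵥ Y ω) - ε ω ⬝ᵥ (residual (Z ω) *ᵥ ε ω)| ≤
      (β ^ 2 + β) * (X ω ⬝ᵥ (residual (Z ω) *ᵥ X ω)) + β * (ε ω ⬝ᵥ (residual (Z ω) *ᵥ ε ω)) := by
  rw [dotProduct_residual_mulVec_self _ (Y ω), hM.residual_mulVec_response hω,
    dotProduct_residual_mulVec_self _ (X ω), dotProduct_residual_mulVec_self _ (ε ω)]
  set a := residual (Z ω) *ᵥ X ω
  set b := residual (Z ω) *ᵥ ε ω
  have h1 : (β • a + b) ⬝ᵥ (β • a + b) - b ⬝ᵥ b = β ^ 2 * (a ⬝ᵥ a) + 2 * β * (a ⬝ᵥ b) := by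
    simp only [add_dotProduct, dotProduct_add, smul_dotProduct, dotProduct_smul, smul_eq_mul,
      dotProduct_comm b a]
    ring
  have h2 : 0 ≤ (a + b) ⬝ᵥ (a + b) := Finset.sum_nonneg fun i _ => mul_self_nonneg _
  have h3 : 0 ≤ (a - b) ⬝ᵥ (a - b) := Finset.sum_nonneg fun i _ => mul_self_nonneg _
  have h4 : 0 ≤ a ⬝ᵥ a := Finset.sum_nonneg fun i _ => mul_self_nonneg _
  simp only [add_dotProduct, dotProduct_add, sub_dotProduct, dotProduct_sub,
    dotProduct_comm b a] at h2 h3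
  rw [h1, abs_le]
  constructor
  · nlinarith [mul_nonneg hβ h2, mul_nonneg (sq_nonneg β) h4]
  · nlinarith [mul_nonneg hβ h3]

end IsLinearModel

end Model

/-! ### Proportional asymptotics -/

/-- Variances of order `n` give concentration at scale `n`. -/
lemma tendsto_div_whp {ι : Type*} {l : Filter ι} {Ω : ι → Type*} [∀ i, MeasurableSpace (Ω i)]
    {P : ∀ i, Measure (Ω i)} {n : ι → ℕ} (hn : Tendsto n l atTop) {R : (Σ i, Ω i) → ℝ}
    {m : ι → ℝ} {a C : ℝ}
    (hR : ∀ᶠ i in l, ∀ c > 0,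
      P i {ω | c ≤ |R ⟨i, ω⟩ - m i|} ≤ ENNReal.ofReal (n i * C / c ^ 2))
    (hm : Tendsto (fun i => m i / n i) l (𝓝 a)) :
    Tendsto (fun x => R x / n x.1) (whp l P) (𝓝 a) := by
  have hn0 : ∀ᶠ i in l, 0 < n i := hn.eventually (eventually_gt_atTop 0)
  have h1 : Tendsto (fun x => (R x - m x.1) / n x.1) (whp l P) (𝓝 0) := by
    rw [Metric.tendsto_nhds]
    intro δ hδ
    rw [eventually_whp]
    have hlim : Tendsto (fun i => ENNReal.ofReal (C / δ ^ 2 / n i)) l (𝓝 0) := by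
      have h2 : Tendsto (fun i => C / δ ^ 2 / (n i : ℝ)) l (𝓝 0) :=
        (tendsto_const_div_atTop_nhds_zero_nat (C / δ ^ 2)).comp hn
      simpa using ENNReal.tendsto_ofReal h2
    refine tendsto_of_tendsto_of_tendsto_of_le_of_le' tendsto_const_nhds hlim
      (Eventually.of_forall fun _ => zero_le) ?_
    filter_upwards [hR, hn0] with i hi hi0
    have hi0' : (0 : ℝ) < n i := by exact_mod_cast hi0
    have hset : {ω | ¬ dist ((R ⟨i, ω⟩ - m i) / n i) 0 < δ} = {ω | δ * n i ≤ |R ⟨i, ω⟩ - m i|} := by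
      ext ω
      simp only [Set.mem_ofPred_eq, not_lt, Real.dist_eq, sub_zero, abs_div, abs_of_pos hi0',
        le_div_iff₀ hi0']
    rw [hset]
    refine (hi _ (by positivity)).trans (ENNReal.ofReal_le_ofReal (le_of_eq ?_))
    field_simp
  have h2 := h1.add (hm.comp tendsto_fst_whp)
  rw [zero_add] at h2
  refine h2.congr fun x => ?_
  rw [Function.comp_apply, ← add_div, sub_add_cancel]

section Asymptotics

variable {d : ℕ → ℕ} {S : ∀ n, Matrix (Fin (d n)) (Fin (d n)) ℝ} {ξ θ : ∀ n, Fin (d n) → ℝ}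
  {h σ κ : ℝ} {Ω : ℕ → Type*} [∀ n, MeasurableSpace (Ω n)] {P : ∀ n, Measure (Ω n)}
  {X : ∀ n, Ω n → Fin n → ℝ}
  {Z : ∀ n, Ω n → Fin n → EuclideanSpace ℝ (Fin (d n))} {ε Y : ∀ n, Ω n → Fin n → ℝ}

lemma eventually_le_of_tendsto_div (hκ1 : κ < 1)
    (hd : Tendsto (fun n => (d n : ℝ) / n) atTop (𝓝 κ)) : ∀ᶠ n in atTop, d n ≤ n := by
  filter_upwards [hd.eventually (gt_mem_nhds hκ1), eventually_gt_atTop 0] with n hn hn0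
  rw [div_lt_one (by exact_mod_cast hn0)] at hn
  exact_mod_cast hn.le

lemma tendsto_sub_div (hd : Tendsto (fun n => (d n : ℝ) / n) atTop (𝓝 κ)) :
    Tendsto (fun n : ℕ => ((n : ℝ) - d n) / n) atTop (𝓝 (1 - κ)) := by
  refine (hd.const_sub 1).congr' ?_
  filter_upwards [eventually_gt_atTop 0] with n hn
  have : (n : ℝ) ≠ 0 := by exact_mod_cast hn.ne'
  rw [sub_div, div_self this]

lemma eventually_whp_isUnit (hκ1 : κ < 1) (hd : Tendsto (fun n => (d n : ℝ) / n) atTop (𝓝 κ))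
    (hS : ∀ n, (S n).PosDef)
    (hM : ∀ n, IsLinearModel (S n) (ξ n) (θ n) (h / √(n : ℝ)) σ (P n) (X n) (Z n) (ε n) (Y n)) :
    ∀ᶠ x in whp atTop P, IsUnit ((rowMatrix (Z x.1 x.2))ᵀ * rowMatrix (Z x.1 x.2)).det := by
  refine eventually_whp_of_ae ?_
  filter_upwards [eventually_le_of_tendsto_div hκ1 hd] with n hn
  exact (hM n).ae_isUnit (hS n) hn

variable [∀ n, IsProbabilityMeasure (P n)]

lemma tendsto_covariate_quadForm (hκ1 : κ < 1)
    (hd : Tendsto (fun n => (d n : ℝ) / n) atTop (𝓝 κ)) (hS : ∀ n, (S n).PosDef)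
    (hM : ∀ n, IsLinearModel (S n) (ξ n) (θ n) (h / √(n : ℝ)) σ (P n) (X n) (Z n) (ε n) (Y n)) :
    Tendsto (fun x => X x.1 x.2 ⬝ᵥ (residual (Z x.1 x.2) *ᵥ X x.1 x.2) / x.1) (whp atTop P)
      (𝓝 (1 - κ)) := by
  refine tendsto_div_whp (n := fun n => n)
      (C := Var[fun x => x ^ 2; gaussianReal 0 1]) tendsto_id ?_ (tendsto_sub_div hd)
  filter_upwards [eventually_le_of_tendsto_div hκ1 hd] with n hn c hc
  exact (hM n).covariate_quadForm_le (hS n) hn hc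

lemma tendsto_noise_quadForm (hσ : 0 < σ) (hκ1 : κ < 1)
    (hd : Tendsto (fun n => (d n : ℝ) / n) atTop (𝓝 κ)) (hS : ∀ n, (S n).PosDef)
    (hM : ∀ n, IsLinearModel (S n) (ξ n) (θ n) (h / √(n : ℝ)) σ (P n) (X n) (Z n) (ε n) (Y n)) :
    Tendsto (fun x => ε x.1 x.2 ⬝ᵥ (residual (Z x.1 x.2) *ᵥ ε x.1 x.2) / x.1) (whp atTop P)
      (𝓝 (σ ^ 2 * (1 - κ))) := by
  have h1 : Tendsto (fun x => ((σ⁻¹ • ε x.1 x.2) ⬝ᵥ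
      (residual (Z x.1 x.2) *ᵥ (σ⁻¹ • ε x.1 x.2))) / x.1) (whp atTop P) (𝓝 (1 - κ)) := by
    refine tendsto_div_whp (n := fun n => n)
      (C := Var[fun x => x ^ 2; gaussianReal 0 1]) tendsto_id ?_ (tendsto_sub_div hd)
    filter_upwards [eventually_le_of_tendsto_div hκ1 hd] with n hn c hc
    exact (hM n).noise_quadForm_le (hS n) hσ hn hc
  refine (h1.const_mul (σ ^ 2)).congr fun x => ?_
  rw [Matrix.mulVec_smul, smul_dotProduct, dotProduct_smul, smul_eq_mul, smul_eq_mul]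
  field_simp

lemma tendsto_response_quadForm (hh : 0 < h) (hσ : 0 < σ) (hκ1 : κ < 1)
    (hd : Tendsto (fun n => (d n : ℝ) / n) atTop (𝓝 κ)) (hS : ∀ n, (S n).PosDef)
    (hM : ∀ n, IsLinearModel (S n) (ξ n) (θ n) (h / √(n : ℝ)) σ (P n) (X n) (Z n) (ε n) (Y n)) :
    Tendsto (fun x => Y x.1 x.2 ⬝ᵥ (residual (Z x.1 x.2) *ᵥ Y x.1 x.2) / x.1) (whp atTop P)
      (𝓝 (σ ^ 2 * (1 - κ))) := by
  have hX := tendsto_covariate_quadForm hκ1 hd hS hM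
  have hε := tendsto_noise_quadForm hσ hκ1 hd hS hM
  have hβ : Tendsto (fun x : Σ n, Ω n => h / √(x.1 : ℝ)) (whp atTop P) (𝓝 0) := by
    have h1 : Tendsto (fun n : ℕ => h / √(n : ℝ)) atTop (𝓝 0) :=
      tendsto_const_nhds.div_atTop (Real.tendsto_sqrt_atTop.comp tendsto_natCast_atTop_atTop)
    exact h1.comp tendsto_fst_whp
  have hbound := (((hβ.pow 2).add hβ).mul hX).add (hβ.mul hε)
  norm_num at hbound
  have h0 := squeeze_zero_norm' (f := fun x => Y x.1 x.2 ⬝ᵥ (residual (Z x.1 x.2) *ᵥ Y x.1 x.2) / x.1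
    - ε x.1 x.2 ⬝ᵥ (residual (Z x.1 x.2) *ᵥ ε x.1 x.2) / x.1) ?_ hbound
  · simpa using h0.add hε
  · filter_upwards [eventually_whp_isUnit hκ1 hd hS hM] with x hx
    have h1 := (hM x.1).abs_response_quadForm_sub_le hx (by positivity)
    rw [Real.norm_eq_abs, ← sub_div, abs_div, Nat.abs_cast, mul_div_assoc', mul_div_assoc',
      ← add_div]
    gcongr

/-- The limit of the rescaled cutoff of the conditional randomization test. -/
lemma tendsto_crtCutoff (hh : 0 < h) (hσ : 0 < σ) (hκ1 : κ < 1)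
    (hd : Tendsto (fun n => (d n : ℝ) / n) atTop (𝓝 κ)) (hS : ∀ n, (S n).PosDef)
    (hM : ∀ n, IsLinearModel (S n) (ξ n) (θ n) (h / √(n : ℝ)) σ (P n) (X n) (Z n) (ε n) (Y n))
    {f : ℝ → ℝ} (hf : IsSided f) {q α : ℝ}
    (hgt : ∀ t, q < t → 1 - α < (gaussianReal 0 1).real {x | f x ≤ t})
    (hlt : ∀ t, t < q → (gaussianReal 0 1).real {x | f x ≤ t} < 1 - α) :
    Tendsto (fun x : Σ n, Ω n => √(x.1 : ℝ) * crtCutoff (covariateKernel (ξ x.1))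
      (fun x z y => f (olsCoef x z y)) (Z x.1 x.2) (Y x.1 x.2) α) (whp atTop P)
      (𝓝 (√(σ ^ 2 * (1 - κ)) / (1 - κ) * q)) := by
  have hκ : 0 < 1 - κ := sub_pos.2 hκ1
  have hY := tendsto_response_quadForm hh hσ hκ1 hd hS hM
  have hunit := eventually_whp_isUnit hκ1 hd hS hM
  have hn : ∀ᶠ x in whp atTop P, 0 < (x.1 : ℝ) :=
    (tendsto_fst_whp.eventually (eventually_gt_atTop 0)).mono fun x hx => by exact_mod_cast hx
  have hYpos : ∀ᶠ x in whp atTop P,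
      0 < Y x.1 x.2 ⬝ᵥ (residual (Z x.1 x.2) *ᵥ Y x.1 x.2) := by
    filter_upwards [hY.eventually (lt_mem_nhds (by positivity)), hn] with x hx hx0
    exact (div_pos_iff_of_pos_right hx0).1 hx
  -- The conditional laws of the resampled covariate, one for each outcome of the sample.
  let K : ∀ x : Σ n, Ω n, Measure (Fin x.1 → ℝ) := fun x => covariateKernel (ξ x.1) (Z x.1 x.2)
  have hD : Tendsto (fun w : Σ x : Σ n, Ω n, Fin x.1 → ℝ =>
      w.2 ⬝ᵥ (residual (Z w.1.1 w.1.2) *ᵥ w.2) / w.1.1) (whp (whp atTop P) K) (𝓝 (1 - κ)) := by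
    refine tendsto_div_whp (n := fun x : Σ n, Ω n => x.1)
      (C := Var[fun x => x ^ 2; gaussianReal 0 1]) tendsto_fst_whp
      (m := fun x : Σ n, Ω n => (x.1 : ℝ) - d x.1) ?_ ((tendsto_sub_div hd).comp tendsto_fst_whp)
    filter_upwards [hunit] with x hx c hc
    exact covariateKernel_quadForm_le (ξ x.1) hx hc
  refine tendsto_mul_quantile (P := K)
    (N := fun x w => (√(Y x.1 x.2 ⬝ᵥ (residual (Z x.1 x.2) *ᵥ Y x.1 x.2)))⁻¹ *
      w ⬝ᵥ (residual (Z x.1 x.2) *ᵥ Y x.1 x.2))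
    (V := fun w => √(Y w.1.1 w.1.2 ⬝ᵥ (residual (Z w.1.1 w.1.2) *ᵥ Y w.1.1 w.1.2) / w.1.1) /
      (w.2 ⬝ᵥ (residual (Z w.1.1 w.1.2) *ᵥ w.2) / w.1.1))
    (T := fun w => f (olsCoef w.2 (Z w.1.1 w.1.2) (Y w.1.1 w.1.2)))
    (b := fun x => √(x.1 : ℝ)) ?_ hf (by positivity) ?_ ?_ ?_ hgt hlt
  · filter_upwards [hunit, hYpos] with x hx hx0
    exact hasLaw_covariateKernel (ξ x.1) hx hx0
  · exact hn.mono fun x hx => Real.sqrt_pos.2 hx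
  · exact ((hY.sqrt).comp tendsto_fst_whp).div hD hκ.ne'
  · filter_upwards [tendsto_fst_whp.eventually hunit, tendsto_fst_whp.eventually hYpos,
      tendsto_fst_whp.eventually hn, hD.eventually (lt_mem_nhds hκ)] with w hw hw1 hw2 hw3
    have hw4 := (div_pos_iff_of_pos_right hw2).1 hw3
    rw [← hf.map_mul _ _ (Real.sqrt_nonneg _), ← hf.map_mul _ _ (by positivity),
      olsCoef_eq_div hw hw4.ne', Real.sqrt_div hw1.le]
    congr 1
    have h1 := (Real.sqrt_pos.2 hw1).ne'
    have h2 := (Real.sqrt_pos.2 hw2).ne'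
    have h3 := Real.sq_sqrt hw2.le
    field_simp
    rw [h3, mul_comm]

/-- The limiting powers, for either sidedness `f`, of the conditional randomization test and of
the fixed-`X` test. Both reject when `f (M + N)` exceeds a critical value converging to `q`, where
`N` is standard normal and `M = (h / σ) √(xᵀ Q x / n)` converges to `(h / σ) √(1 - κ)`. -/
lemma tendsto_crtPower_and_fixedX (hh : 0 < h) (hσ : 0 < σ) (hκ1 : κ < 1)
    (hd : Tendsto (fun n => (d n : ℝ) / n) atTop (𝓝 κ)) (hS : ∀ n, (S n).PosDef)
    (hM : ∀ n, IsLinearModel (S n) (ξ n) (θ n) (h / √(n : ℝ)) σ (P n) (X n) (Z n) (ε n) (Y n))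
    {f : ℝ → ℝ} (hf : IsSided f) {q α : ℝ}
    (hgt : ∀ t, q < t → 1 - α < (gaussianReal 0 1).real {x | f x ≤ t})
    (hlt : ∀ t, t < q → (gaussianReal 0 1).real {x | f x ≤ t} < 1 - α) :
    Tendsto (fun n => crtPower (covariateKernel (ξ n)) (fun x z y => f (olsCoef x z y)) (P n)
      (X n) (Z n) (Y n) α) atTop
      (𝓝 ((gaussianReal 0 1).real {x | q ≤ f (h / σ * √(1 - κ) + x)})) ∧
    Tendsto (fun n => (P n).real {ω |
      q * (σ * √(gramInv (X n ω) (Z n ω) (.inl ()) (.inl ()))) <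
        f (olsCoef (X n ω) (Z n ω) (Y n ω))}) atTop
      (𝓝 ((gaussianReal 0 1).real {x | q ≤ f (h / σ * √(1 - κ) + x)})) := by
  have hκ : 0 < 1 - κ := sub_pos.2 hκ1
  have hX := tendsto_covariate_quadForm hκ1 hd hS hM
  have hunit := eventually_whp_isUnit hκ1 hd hS hM
  have hn : ∀ᶠ x in whp atTop P, 0 < (x.1 : ℝ) :=
    (tendsto_fst_whp.eventually (eventually_gt_atTop 0)).mono fun x hx => by exact_mod_cast hx
  have hXpos : ∀ᶠ x in whp atTop P,
      0 < X x.1 x.2 ⬝ᵥ (residual (Z x.1 x.2) *ᵥ X x.1 x.2) := by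
    filter_upwards [hX.eventually (lt_mem_nhds hκ), hn] with x hx hx0
    exact (div_pos_iff_of_pos_right hx0).1 hx
  obtain ⟨N, hN⟩ : ∃ N : ∀ n, Ω n → ℝ, ∀ n, 0 < n → HasLaw (N n) (gaussianReal 0 1) (P n) ∧
      ∀ ω, 0 < X n ω ⬝ᵥ (residual (Z n ω) *ᵥ X n ω) → X n ω ⬝ᵥ (residual (Z n ω) *ᵥ ε n ω) =
        σ * √(X n ω ⬝ᵥ (residual (Z n ω) *ᵥ X n ω)) * N n ω := by
    have : ∀ n, ∃ N : Ω n → ℝ, 0 < n → HasLaw N (gaussianReal 0 1) (P n) ∧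
        ∀ ω, 0 < X n ω ⬝ᵥ (residual (Z n ω) *ᵥ X n ω) → X n ω ⬝ᵥ (residual (Z n ω) *ᵥ ε n ω) =
        σ * √(X n ω ⬝ᵥ (residual (Z n ω) *ᵥ X n ω)) * N ω := by
      intro n
      by_cases h0 : 0 < n
      · obtain ⟨N, hN⟩ := (hM n).exists_standard_normal hσ h0
        exact ⟨N, fun _ => hN⟩
      · exact ⟨fun _ => 0, fun h => absurd h h0⟩
    choose N hN using this
    exact ⟨N, hN⟩
  have hlaw : ∀ᶠ n in atTop, HasLaw (N n) (gaussianReal 0 1) (P n) :=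
    (eventually_gt_atTop 0).mono fun n hn => (hN n hn).1
  have hMlim : Tendsto (fun x : Σ n, Ω n =>
      h / σ * √(X x.1 x.2 ⬝ᵥ (residual (Z x.1 x.2) *ᵥ X x.1 x.2) / x.1)) (whp atTop P)
      (𝓝 (h / σ * √(1 - κ))) := hX.sqrt.const_mul _
  -- The standardized estimate.
  have hstd : ∀ᶠ x in whp atTop P,
      √(X x.1 x.2 ⬝ᵥ (residual (Z x.1 x.2) *ᵥ X x.1 x.2)) / σ *
        f (olsCoef (X x.1 x.2) (Z x.1 x.2) (Y x.1 x.2)) =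
      f (h / σ * √(X x.1 x.2 ⬝ᵥ (residual (Z x.1 x.2) *ᵥ X x.1 x.2) / x.1) + N x.1 x.2) := by
    filter_upwards [hunit, hn, hXpos] with x hx hx0 hx1
    rw [← hf.map_mul _ _ (by positivity), (hM x.1).olsCoef_eq_add hx hx1,
      (hN x.1 (by exact_mod_cast hx0)).2 x.2 hx1, Real.sqrt_div hx1.le]
    congr 1
    have h1 := (Real.sqrt_pos.2 hx1).ne'
    have h2 := (Real.sqrt_pos.2 hx0).ne'
    have h3 := Real.sq_sqrt hx1.le
    field_simp
    linear_combination σ * √(x.1 : ℝ) * N x.1 x.2 * h3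
  constructor
  · have hc := tendsto_crtCutoff hh hσ hκ1 hd hS hM hf hgt hlt
    have hA : Tendsto (fun x : Σ n, Ω n =>
        √(X x.1 x.2 ⬝ᵥ (residual (Z x.1 x.2) *ᵥ X x.1 x.2) / x.1) / σ * (√(x.1 : ℝ) *
          crtCutoff (covariateKernel (ξ x.1)) (fun x z y => f (olsCoef x z y))
          (Z x.1 x.2) (Y x.1 x.2) α)) (whp atTop P) (𝓝 q) := by
      have h1 := (hX.sqrt.div_const σ).mul hc
      have h2 : √(1 - κ) / σ * (√(σ ^ 2 * (1 - κ)) / (1 - κ) * q) = q := by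
        rw [Real.sqrt_mul (sq_nonneg σ), Real.sqrt_sq hσ.le]
        have h3 := Real.sq_sqrt hκ.le
        field_simp
        rw [h3]
      rwa [h2] at h1
    refine tendsto_power hlaw hf hMlim hA (E := fun n => {ω | crtCutoff (covariateKernel (ξ n))
      (fun x z y => f (olsCoef x z y)) (Z n ω) (Y n ω) α ≤
        f (olsCoef (X n ω) (Z n ω) (Y n ω))}) ?_
    filter_upwards [hstd, hn, hXpos] with x hx hx0 hx1
    have h1 : √(X x.1 x.2 ⬝ᵥ (residual (Z x.1 x.2) *ᵥ X x.1 x.2) / x.1) / σ * (√(x.1 : ℝ) *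
          crtCutoff (covariateKernel (ξ x.1)) (fun x z y => f (olsCoef x z y))
          (Z x.1 x.2) (Y x.1 x.2) α) = √(X x.1 x.2 ⬝ᵥ (residual (Z x.1 x.2) *ᵥ X x.1 x.2)) / σ *
          crtCutoff (covariateKernel (ξ x.1)) (fun x z y => f (olsCoef x z y))
          (Z x.1 x.2) (Y x.1 x.2) α := by
      rw [Real.sqrt_div hx1.le]
      have h2 := (Real.sqrt_pos.2 hx0).ne'
      field_simp
    have hpos : 0 < √(X x.1 x.2 ⬝ᵥ (residual (Z x.1 x.2) *ᵥ X x.1 x.2)) / σ :=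
      div_pos (Real.sqrt_pos.2 hx1) hσ
    rw [h1, ← hx, mul_lt_mul_iff_right₀ hpos, mul_le_mul_iff_right₀ hpos]
    exact ⟨fun h => h.le, fun h => h⟩
  · refine tendsto_power hlaw hf hMlim (tendsto_const_nhds (x := q)) (E := fun n => {ω |
      q * (σ * √(gramInv (X n ω) (Z n ω) (.inl ()) (.inl ()))) <
        f (olsCoef (X n ω) (Z n ω) (Y n ω))}) ?_
    filter_upwards [hstd, hunit, hXpos] with x hx hx0 hx1
    have hpos : 0 < √(X x.1 x.2 ⬝ᵥ (residual (Z x.1 x.2) *ᵥ X x.1 x.2)) / σ :=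
      div_pos (Real.sqrt_pos.2 hx1) hσ
    have h1 : q = √(X x.1 x.2 ⬝ᵥ (residual (Z x.1 x.2) *ᵥ X x.1 x.2)) / σ *
        (q * (σ * √(gramInv (X x.1 x.2) (Z x.1 x.2) (.inl ()) (.inl ())))) := by
      rw [gramInv_inl_inl hx0 hx1.ne', Real.sqrt_inv]
      have h2 := (Real.sqrt_pos.2 hx1).ne'
      field_simp
    have h2 : x.2 ∈ {ω | q * (σ * √(gramInv (X x.1 ω) (Z x.1 ω) (.inl ()) (.inl ()))) <
        f (olsCoef (X x.1 ω) (Z x.1 ω) (Y x.1 ω))} ↔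
        q < f (h / σ * √(X x.1 x.2 ⬝ᵥ (residual (Z x.1 x.2) *ᵥ X x.1 x.2) / x.1) + N x.1 x.2) := by
      rw [← hx]
      conv_rhs => rw [h1]
      rw [mul_lt_mul_iff_right₀ hpos]
      rfl
    exact ⟨h2.2, fun h => (h2.1 h).le⟩

lemma hasZTestPower (hh : 0 < h) (hσ : 0 < σ) (hκ1 : κ < 1)
    (hd : Tendsto (fun n => (d n : ℝ) / n) atTop (𝓝 κ)) (hS : ∀ n, (S n).PosDef)
    (hM : ∀ n, IsLinearModel (S n) (ξ n) (θ n) (h / √(n : ℝ)) σ (P n) (X n) (Z n) (ε n) (Y n)) :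
    HasZTestPower
      (fun n => crtPower (covariateKernel (ξ n)) (fun x z y => olsCoef x z y) (P n) (X n) (Z n)
        (Y n))
      (fun n => crtPower (covariateKernel (ξ n)) (fun x z y => |olsCoef x z y|) (P n) (X n) (Z n)
        (Y n)) (h / σ * √(1 - κ)) ∧
    HasZTestPower (fun n => fixedXPowerOne σ (P n) (X n) (Z n) (Y n))
      (fun n => fixedXPowerTwo σ (P n) (X n) (Z n) (Y n)) (h / σ * √(1 - κ)) := by
  have hone : ∀ α : ℝ, 0 < α → α < 1 → _ := fun α h0 h1 =>
    tendsto_crtPower_and_fixedX hh hσ hκ1 hd hS hM isSided_id (q := zq (1 - α)) (α := α)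
      (fun t ht => lt_Phi_of_zq_lt (by linarith) ht)
      (fun t ht => Phi_lt_of_lt_zq (by linarith) ht)
  have htwo : ∀ α : ℝ, 0 < α → α < 1 → _ := fun α h0 h1 =>
    tendsto_crtPower_and_fixedX hh hσ hκ1 hd hS hM isSided_abs (q := zq (1 - α / 2)) (α := α)
      (fun t ht => by
        rw [real_gaussianReal_abs_le ((zq_nonneg (by linarith) (by linarith)).trans ht.le)]
        linarith [lt_Phi_of_zq_lt (by linarith) ht])
      (fun t ht => by
        rcases le_or_gt 0 t with h2 | h2
        · rw [real_gaussianReal_abs_le h2]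
          linarith [Phi_lt_of_lt_zq (by linarith) ht]
        · have : {x : ℝ | |x| ≤ t} = ∅ :=
            Set.eq_empty_of_forall_notMem fun x hx => absurd (h2.trans_le (abs_nonneg x))
              (not_lt.2 hx)
          rw [this, measureReal_empty]
          linarith)
  constructor <;> intro α h0 h1 <;>
    have h2 := hone α h0 h1 <;> have h3 := htwo α h0 h1 <;>
    rw [real_gaussianReal_le_add] at h2 <;>
    rw [real_gaussianReal_le_abs_add (zq_nonneg (by linarith) (by linarith))] at h3
  exacts [⟨h2.1, h3.1⟩, ⟨h2.2, h3.2⟩]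

end Asymptotics

end CRT

theorem theorem2
    (p : ℕ → ℕ)
    (S : ∀ n, Matrix (Fin (p n - 1)) (Fin (p n - 1)) ℝ)
    (ξ θ : ∀ n, Fin (p n - 1) → ℝ)
    (h σ κ vZ : ℝ)
    (hh : 0 < h) (hσ : 0 < σ) (hκ0 : 0 < κ) (hκ1 : κ < 1)
    (hS : ∀ n, (S n).PosDef)
    (hp : Tendsto (fun n : ℕ => (p n : ℝ) / n) atTop (𝓝 κ))
    (hθ : Tendsto (fun n => θ n ⬝ᵥ (S n *ᵥ θ n)) atTop (𝓝 (vZ ^ 2)))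
    (hξ : IsBoundedUnder (· ≤ ·) atTop fun n => ξ n ⬝ᵥ (S n *ᵥ ξ n))
    (Ω : ℕ → Type*) [∀ n, MeasurableSpace (Ω n)]
    (P : ∀ n, Measure (Ω n)) [∀ n, IsProbabilityMeasure (P n)]
    (X : ∀ n, Ω n → Fin n → ℝ)
    (Z : ∀ n, Ω n → Fin n → EuclideanSpace ℝ (Fin (p n - 1)))
    (ε Y : ∀ n, Ω n → Fin n → ℝ)
    (hmodel : ∀ n, CRT.IsLinearModel (S n) (ξ n) (θ n) (h / √(n : ℝ)) σ
      (P n) (X n) (Z n) (ε n) (Y n)) :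
    CRT.HasZTestPower
      (fun n => CRT.crtPower (CRT.covariateKernel (ξ n))
        (fun x z y => CRT.olsCoef x z y) (P n) (X n) (Z n) (Y n))
      (fun n => CRT.crtPower (CRT.covariateKernel (ξ n))
        (fun x z y => |CRT.olsCoef x z y|) (P n) (X n) (Z n) (Y n))
      (h / σ * √(1 - κ)) ∧
    CRT.HasZTestPower
      (fun n => CRT.fixedXPowerOne σ (P n) (X n) (Z n) (Y n))
      (fun n => CRT.fixedXPowerTwo σ (P n) (X n) (Z n) (Y n))
      (h / σ * √(1 - κ)) := by
  have hd : Tendsto (fun n => ((p n - 1 : ℕ) : ℝ) / n) atTop (𝓝 κ) := by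
    have h1 : Tendsto (fun n : ℕ => (p n : ℝ) / n - 1 / n) atTop (𝓝 κ) := by
      simpa using hp.sub (tendsto_const_div_atTop_nhds_zero_nat (1 : ℝ))
    refine h1.congr' ?_
    -- As `κ > 0`, eventually `p n ≠ 0` and the subtraction is not truncated.
    filter_upwards [hp.eventually (lt_mem_nhds hκ0)] with n hn
    have hpn : 1 ≤ p n := by
      by_contra! hc
      rw [Nat.lt_one_iff.1 hc] at hn
      simp at hn
    rw [Nat.cast_sub hpn, Nat.cast_one, sub_div]
  exact CRT.hasZTestPower hh hσ hκ1 hd hS hmodel
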